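/- Let $X$ be a (real or complex) Banach space, $0<\alpha\le 2$, and let $A$ be a densely defined closed linear operator on $X$, with $D(A^2)=\{x\in D(A): Ax\in D(A)\}$. For $\gamma>0$ put $g_\gamma(t)=t^{\gamma-1}/\Gamma(\gamma)$ for $t>0$, $g_\gamma(t)=0$ for $t\le 0$, and $(J^\gamma u)(t)=\int_0^t g_\gamma(t-s)u(s)\,ds$. For a linear operator $B$ on $X$ and a continuous $f:[0,\infty)\to X$ consider the Volterra equation $$u(t)=f(t)+\int_0^t g_\gamma(t-s)\,Bu(s)\,ds,\qquad t\ge 0. \tag{$V_{\gamma,B,f}$}$$ A continuous $u:[0,\infty)\to X$ is a strong solution if $u(t)\in D(B)$ and the equation holds (with the integral existing as a Bochner integral) for all $t\ge0$; it is a mild solution if $(J^\gamma u)(t)\in D(B)$ and $u(t)=f(t)+B(J^\gamma u)(t)$ for all $t\ge 0$. The equation is called well-posed (a property of $\gamma$ and $B$ only, not of $f$) if for every $x\in D(B)$ the equation with $f\equiv x$ has a unique strong solution $u(\cdot\,;x)$ on $[0,\infty)$, and if $x_n\in D(B)$, $x_n\to0$ in $X$ imply $u(t;x_n)\to0$ uniformly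 on compact $t$-intervals. Let $f:[0,\infty)\to X$ be continuous with $f\in W^{1,1}([0,T];X)$ for every $T>0$, i.e. for every $T>0$ there are $c\in X$ and $\varphi\in L^1((0,T);X)$ with $f(t)=c+\int_0^t\varphi(s)\,ds$ on $[0,T]$. Suppose that the two Volterra equations $$u^{+}_{\alpha/2}=f+J^{\alpha/2}Au^{+}_{\alpha/2},\qquad u^{-}_{\alpha/2}=f-J^{\alpha/2}Au^{-}_{\alpha/2}$$ are well-posed. Then $A^2$ is closed and densely defined, and the Volterra equation $$u_\alpha=f+J^{\alpha}A^2u_\alpha$$ is also well-posed. Moreover, each of the three equations has a unique mild solution, and the mild solutions satisfy $$u_\alpha(t)=\tfrac12\bigl(u^{+}_{\alpha/2}(t)+u^{-}_{\alpha/2}(t)\bigr),\qquad t\ge0.$$ -/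

import Mathlib

open MeasureTheory Set Filter Topology

noncomputable section

/-- The square `A² = A ∘ A` of a partially defined operator, with its natural domain
`D(A²) = {x ∈ D(A) | A x ∈ D(A)}`. -/
def operatorSq {𝕜 X : Type*} [RCLike 𝕜] [AddCommGroup X] [Module 𝕜 X]
    (A : X →ₗ.[𝕜] X) : X →ₗ.[𝕜] X where
  domain := (A.domain.comap A.toFun).map A.domain.subtype
  toFun :=
    { toFun := fun x => A ⟨A ⟨x, by
          obtain ⟨y, -, hy⟩ := x.2
          exact hy ▸ y.2⟩, by
          obtain ⟨x, y, hy, rfl⟩ := x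
          exact hy⟩
      map_add' := fun x y => by
        rw [← A.map_add]
        congr 1
        ext
        exact A.map_add ⟨x, _⟩ ⟨y, _⟩
      map_smul' := fun c x => by
        rw [RingHom.id_apply, ← A.map_smul]
        congr 1
        ext
        exact A.map_smul c ⟨x, _⟩ }

theorem mem_operatorSq_domain {𝕜 X : Type*} [RCLike 𝕜] [AddCommGroup X] [Module 𝕜 X]
    (A : X →ₗ.[𝕜] X) (x : X) :
    x ∈ (operatorSq A).domain ↔ ∃ h : x ∈ A.domain, A ⟨x, h⟩ ∈ A.domain := by
  constructor
  · rintro ⟨y, hy, rfl⟩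
    exact ⟨y.2, hy⟩
  · rintro ⟨h, h'⟩
    exact ⟨⟨x, h⟩, h', rfl⟩

theorem operatorSq_apply {𝕜 X : Type*} [RCLike 𝕜] [AddCommGroup X] [Module 𝕜 X]
    (A : X →ₗ.[𝕜] X) (x : X) (h : x ∈ A.domain) (h' : A ⟨x, h⟩ ∈ A.domain)
    (hx : x ∈ (operatorSq A).domain) :
    operatorSq A ⟨x, hx⟩ = A ⟨A ⟨x, h⟩, h'⟩ := rfl

/-- The kernel `g_α(t) = t^(α-1) / Γ(α)` for `t > 0`, and `0` for `t ≤ 0`. -/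
def fracKernel (α t : ℝ) : ℝ :=
  if 0 < t then t ^ (α - 1) / Real.Gamma α else 0

/-- The Riemann-Liouville integral `(J^α u)(t) = (g_α * u)(t) = ∫₀ᵗ g_α(t - s) u(s) ds`
(of order `α > 0`). -/
def fracIntegral {X : Type*} [NormedAddCommGroup X] [NormedSpace ℝ X]
    (α : ℝ) (u : ℝ → X) (t : ℝ) : X :=
  ∫ s in (0 : ℝ)..t, fracKernel α (t - s) • u s

/-- `f ∈ W^{1,1}([0,T]; X)`: `f(t) = c + ∫₀ᵗ φ(s) ds` on `[0,T]` with `φ ∈ L¹((0,T); X)`. -/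
def MemW11 {X : Type*} [NormedAddCommGroup X] [NormedSpace ℝ X]
    (T : ℝ) (f : ℝ → X) : Prop :=
  ∃ (c : X) (φ : ℝ → X), IntegrableOn φ (Ioo 0 T) ∧
    ∀ t ∈ Icc 0 T, f t = c + ∫ s in (0 : ℝ)..t, φ s

/-- `u` is a strong solution of `u(t) = f(t) + ∫₀ᵗ g_α(t - s) B u(s) ds`, `t ≥ 0`: `u` is
continuous on `[0,∞)`, `u(t) ∈ D(B)` for all `t ≥ 0`, and the equation holds for all `t ≥ 0`,
the integral existing as a Bochner integral. The function `v` is `t ↦ B u(t)`. -/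
def IsStrongSolution {𝕜 X : Type*} [RCLike 𝕜] [NormedAddCommGroup X] [NormedSpace ℝ X]
    [NormedSpace 𝕜 X] (α : ℝ) (B : X →ₗ.[𝕜] X) (f u : ℝ → X) : Prop :=
  ContinuousOn u (Ici 0) ∧ ∃ v : ℝ → X,
    (∀ t, 0 ≤ t → ∃ h : u t ∈ B.domain, v t = B ⟨u t, h⟩) ∧
    ∀ t, 0 ≤ t → IntervalIntegrable (fun s => fracKernel α (t - s) • v s) volume 0 t ∧
      u t = f t + fracIntegral α v t

/-- `u` is a mild solution of `u(t) = f(t) + ∫₀ᵗ g_α(t - s) B u(s) ds`, `t ≥ 0`: `u` is continuous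
on `[0,∞)`, and `(g_α * u)(t) ∈ D(B)` and `u(t) = f(t) + B (g_α * u)(t)` for all `t ≥ 0`. -/
def IsMildSolution {𝕜 X : Type*} [RCLike 𝕜] [NormedAddCommGroup X] [NormedSpace ℝ X]
    [NormedSpace 𝕜 X] (α : ℝ) (B : X →ₗ.[𝕜] X) (f u : ℝ → X) : Prop :=
  ContinuousOn u (Ici 0) ∧
    ∀ t, 0 ≤ t → ∃ h : fracIntegral α u t ∈ B.domain, u t = f t + B ⟨fracIntegral α u t, h⟩

/-- `u` is a mild solution, and every mild solution agrees with `u` on `[0,∞)`. -/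
def IsUniqueMildSolution {𝕜 X : Type*} [RCLike 𝕜] [NormedAddCommGroup X] [NormedSpace ℝ X]
    [NormedSpace 𝕜 X] (α : ℝ) (B : X →ₗ.[𝕜] X) (f u : ℝ → X) : Prop :=
  IsMildSolution α B f u ∧ ∀ w, IsMildSolution α B f w → EqOn w u (Ici 0)

/-- Well-posedness (in the sense of Prüss) of the Volterra equation with kernel `g_α` and
operator `B`; it does not depend on the forcing function. For every `x ∈ D(B)` the equation
`u(t) = x + ∫₀ᵗ g_α(t - s) B u(s) ds` has a unique strong solution `u(·; x)` on `[0,∞)`, and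
`D(B) ∋ xₙ → 0` in `X` implies `u(t; xₙ) → 0` uniformly for `t` in compact intervals. -/
structure IsWellPosed {𝕜 X : Type*} [RCLike 𝕜] [NormedAddCommGroup X] [NormedSpace ℝ X]
    [NormedSpace 𝕜 X] (α : ℝ) (B : X →ₗ.[𝕜] X) : Prop where
  exists_strong : ∀ x ∈ B.domain, ∃ u, IsStrongSolution α B (fun _ => x) u
  unique_strong : ∀ x ∈ B.domain, ∀ u w, IsStrongSolution α B (fun _ => x) u →
    IsStrongSolution α B (fun _ => x) w → EqOn u w (Ici 0)
  continuous_dependence : ∀ (x : ℕ → X) (u : ℕ → ℝ → X), (∀ n, x n ∈ B.domain) →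
    (∀ n, IsStrongSolution α B (fun _ => x n) (u n)) → Tendsto x atTop (𝓝 0) →
    ∀ T, 0 < T → TendstoUniformlyOn u (fun _ => 0) atTop (Icc 0 T)

end

/-! ### The kernel `fracKernel` -/

/-! Put `γ = α / 2` and `a = J^γ A`. Formally `1 - a² = (1 - a)(1 + a)`, so `(1 - a²)⁻¹` is the mean
of `(1 - a)⁻¹` and `(1 + a)⁻¹`; the semigroup law `J^γ J^γ = J^(2γ)` makes `a²` equal to `J^α A²`.
Closedness of `A` lets it pass through `J^γ`, so the mean of the two mild solutions solves the
squared equation (`isMildSolution_operatorSq`).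

For uniqueness, let `w` be a mild solution of the squared equation with zero forcing, and set `W =
J^α w`, `q = J^γ w`, `p = A W`. Then `q + p` and `q - p` solve the homogeneous equations for `A` and
`-A`, so `q = 0`, hence `W = 0` and `w = A² W = 0` (`eqOn_zero_of_isMildSolution_operatorSq`). This
requires `p` to be continuous. The resolvent family of `A` provides that: it expresses `A x` as a
continuous function of `(x, A² x)` (`IsResolvent.eq_of_mem_graph`), which also shows that `A²` is
closed.

Well-posedness yields resolvent families for `±A` (`IsWellPosed.exists_resolvent`), and variation of
parameters turns these into mild solutions for `W^{1,1}` forcing. -/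

theorem fracKernel_of_nonpos (γ : ℝ) {t : ℝ} (ht : t ≤ 0) : fracKernel γ t = 0 :=
  if_neg ht.not_gt

theorem fracKernel_of_pos (γ : ℝ) {t : ℝ} (ht : 0 < t) :
    fracKernel γ t = t ^ (γ - 1) / Real.Gamma γ :=
  if_pos ht

theorem fracKernel_nonneg {γ : ℝ} (hγ : 0 < γ) (t : ℝ) : 0 ≤ fracKernel γ t := by
  unfold fracKernel
  split_ifs with h
  · exact div_nonneg (Real.rpow_nonneg h.le _) (Real.Gamma_pos_of_pos hγ).le
  · exact le_rfl

theorem measurable_fracKernel (γ : ℝ) : Measurable (fracKernel γ) :=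
  Measurable.ite measurableSet_Ioi ((measurable_id.pow_const _).div_const _) measurable_const

theorem intervalIntegrable_fracKernel {γ : ℝ} (hγ : 0 < γ) (a b : ℝ) :
    IntervalIntegrable (fracKernel γ) volume a b := by
  have h : IntervalIntegrable (fun t : ℝ => t ^ (γ - 1) / Real.Gamma γ) volume a b :=
    (intervalIntegral.intervalIntegrable_rpow' (by linarith)).div_const _
  have h2 : fracKernel γ = (Ioi (0 : ℝ)).indicator (fun t : ℝ => t ^ (γ - 1) / Real.Gamma γ) := by
    ext t
    simp [fracKernel, indicator]
  rw [h2]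
  rw [intervalIntegrable_iff] at h ⊢
  exact h.indicator measurableSet_Ioi

theorem intervalIntegrable_fracKernel_sub {γ : ℝ} (hγ : 0 < γ) (t a b : ℝ) :
    IntervalIntegrable (fun s => fracKernel γ (t - s)) volume a b := by
  have := (intervalIntegrable_fracKernel hγ (t - a) (t - b)).comp_sub_left t
  simpa using this

theorem integral_fracKernel_sub {γ : ℝ} (hγ : 0 < γ) {t : ℝ} (ht : 0 ≤ t) :
    ∫ s in (0 : ℝ)..t, fracKernel γ (t - s) = t ^ γ / Real.Gamma (γ + 1) := by
  have h1 : ∫ s in (0 : ℝ)..t, fracKernel γ (t - s) = ∫ s in (0 : ℝ)..t, fracKernel γ s := by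
    simp
  have h2 : ∫ s in (0 : ℝ)..t, fracKernel γ s
      = ∫ s in (0 : ℝ)..t, s ^ (γ - 1) / Real.Gamma γ := by
    apply intervalIntegral.integral_congr_ae
    refine ae_of_all _ fun s hs => ?_
    rw [uIoc_of_le ht] at hs
    exact fracKernel_of_pos γ hs.1
  rw [h1, h2, intervalIntegral.integral_div, integral_rpow (Or.inl (by linarith)),
    Real.Gamma_add_one hγ.ne', sub_add_cancel, Real.zero_rpow hγ.ne', sub_zero, div_div]

/-- Euler's Beta integral, transferred from its complex form; the casts commute with the powers
because both bases are nonnegative on the interval. -/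
theorem integral_rpow_mul_rpow_sub {a b x : ℝ} (ha : 0 < a) (hb : 0 < b) (hx : 0 < x) :
    ∫ s in (0 : ℝ)..x, s ^ (a - 1) * (x - s) ^ (b - 1)
      = x ^ (a + b - 1) * (Real.Gamma a * Real.Gamma b / Real.Gamma (a + b)) := by
  have h := Complex.betaIntegral_scaled (a : ℂ) (b : ℂ) hx
  rw [Complex.betaIntegral_eq_Gamma_mul_div _ _ (by simpa) (by simpa), ← Complex.ofReal_add,
    Complex.Gamma_ofReal, Complex.Gamma_ofReal, Complex.Gamma_ofReal] at h
  have h2 : ∫ s in (0 : ℝ)..x, (s : ℂ) ^ ((a : ℂ) - 1) * ((x : ℂ) - s) ^ ((b : ℂ) - 1)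
      = ((∫ s in (0 : ℝ)..x, s ^ (a - 1) * (x - s) ^ (b - 1) : ℝ) : ℂ) := by
    rw [← intervalIntegral.integral_ofReal]
    apply intervalIntegral.integral_congr
    intro s hs
    rw [uIcc_of_le hx.le] at hs
    simp only [Complex.ofReal_mul]
    rw [Complex.ofReal_cpow hs.1, Complex.ofReal_cpow (sub_nonneg.2 hs.2)]
    push_cast
    rfl
  rw [h2] at h
  have h3 : ((x : ℂ) ^ (((a + b : ℝ) : ℂ) - 1)) = ((x ^ (a + b - 1) : ℝ) : ℂ) := by
    rw [Complex.ofReal_cpow hx.le]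
    push_cast
    rfl
  rw [h3] at h
  exact_mod_cast h

/-- The convolution semigroup property of the kernels. -/
theorem integral_fracKernel_mul_fracKernel {a b : ℝ} (ha : 0 < a) (hb : 0 < b) (t r : ℝ) :
    ∫ s, fracKernel a (t - s) * fracKernel b (s - r) = fracKernel (a + b) (t - r) := by
  rw [← integral_add_right_eq_self (fun s => fracKernel a (t - s) * fracKernel b (s - r)) r]
  simp only [add_sub_cancel_right]
  rcases le_or_gt (t - r) 0 with h | h
  · rw [fracKernel_of_nonpos _ h]
    have : ∀ s, fracKernel a (t - (s + r)) * fracKernel b s = 0 := by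
      intro s
      rcases le_or_gt s 0 with hs | hs
      · rw [fracKernel_of_nonpos b hs, mul_zero]
      · rw [fracKernel_of_nonpos a (by linarith), zero_mul]
    simp [this]
  · set x := t - r with hx
    have h1 : (fun s => fracKernel a (t - (s + r)) * fracKernel b s)
        = (Ioo 0 x).indicator fun s => s ^ (b - 1) * (x - s) ^ (a - 1) *
          (Real.Gamma a * Real.Gamma b)⁻¹ := by
      ext s
      have e : t - (s + r) = x - s := by rw [hx]; ring
      rw [e]
      by_cases hs : s ∈ Ioo 0 x
      · rw [indicator_of_mem hs, fracKernel_of_pos _ hs.1, fracKernel_of_pos _ (sub_pos.2 hs.2)]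
        field_simp
      · rw [indicator_of_notMem hs]
        rcases le_or_gt s 0 with h0 | h0
        · rw [fracKernel_of_nonpos b h0, mul_zero]
        · have : x ≤ s := by
            by_contra hc
            exact hs ⟨h0, not_le.1 hc⟩
          rw [fracKernel_of_nonpos a (by linarith), zero_mul]
    rw [h1, integral_indicator measurableSet_Ioo, ← integral_Ioc_eq_integral_Ioo,
      ← intervalIntegral.integral_of_le h.le, intervalIntegral.integral_mul_const,
      integral_rpow_mul_rpow_sub hb ha h, fracKernel_of_pos _ h, add_comm b a]
    have := (Real.Gamma_pos_of_pos ha).ne'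
    have := (Real.Gamma_pos_of_pos hb).ne'
    field_simp

/-! ### Operator-valued Volterra convolutions -/

section Volterra

variable {X Y : Type*} [NormedAddCommGroup X] [NormedSpace ℝ X]
  [NormedAddCommGroup Y] [NormedSpace ℝ Y]

/-- A jointly continuous operator family is bounded on compact intervals. -/
theorem exists_opNorm_le_of_continuous {K : ℝ → Y →L[ℝ] X}
    (hK : Continuous fun p : ℝ × Y => K p.1 p.2) (a b : ℝ) :
    ∃ M, 0 ≤ M ∧ ∀ τ ∈ Icc a b, ‖K τ‖ ≤ M := by
  have hcomp : IsCompact (Icc a b ×ˢ ({0} : Set Y)) := isCompact_Icc.prod isCompact_singleton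
  have hopen : IsOpen {p : ℝ × Y | ‖K p.1 p.2‖ < 1} := isOpen_lt hK.norm continuous_const
  have hsub : Icc a b ×ˢ ({0} : Set Y) ⊆ {p : ℝ × Y | ‖K p.1 p.2‖ < 1} := by
    rintro ⟨τ, y⟩ ⟨-, hy⟩
    rw [mem_singleton_iff] at hy
    simp only at hy
    simp [hy]
  obtain ⟨u, v, -, hv, hu, h0, huv⟩ :=
    generalized_tube_lemma isCompact_Icc isCompact_singleton hopen hsub
  obtain ⟨ε, hε, hball⟩ := Metric.isOpen_iff.1 hv 0 (h0 rfl)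
  -- The tube lemma gives `‖K τ y‖ < 1` on one ball of radius `ε` for all `τ`; testing on the shell
  -- `ε / 2 ≤ ‖y‖ < ε` gives the constant `2 / ε`.
  refine ⟨2 / ε, by positivity, fun τ hτ => ?_⟩
  refine ContinuousLinearMap.opNorm_le_of_shell hε (by positivity)
    (c := (2 : ℝ)) (by norm_num) fun y hy1 hy2 => ?_
  have h1 : ‖K τ y‖ < 1 := huv (mk_mem_prod (hu hτ) (hball (by simpa using hy2)))
  have h2 : ε / 2 ≤ ‖y‖ := by simpa using hy1
  calc ‖K τ y‖ ≤ 1 := h1.le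
    _ = 2 / ε * (ε / 2) := by field_simp
    _ ≤ 2 / ε * ‖y‖ := by gcongr

theorem aestronglyMeasurable_volterra {K : ℝ → Y →L[ℝ] X}
    (hK : Continuous fun p : ℝ × Y => K p.1 p.2) {φ : ℝ → Y} {μ : Measure ℝ}
    (hφ : AEStronglyMeasurable φ μ) (t : ℝ) :
    AEStronglyMeasurable (fun s => K (t - s) (φ s)) μ :=
  hK.comp_aestronglyMeasurable
    (((continuous_const.sub continuous_id).aestronglyMeasurable).prodMk hφ)

theorem intervalIntegrable_volterra {K : ℝ → Y →L[ℝ] X}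
    (hK : Continuous fun p : ℝ × Y => K p.1 p.2) {φ : ℝ → Y} {a b : ℝ}
    (hφ : IntervalIntegrable φ volume a b) (t : ℝ) :
    IntervalIntegrable (fun s => K (t - s) (φ s)) volume a b := by
  obtain ⟨M, hM0, hM⟩ := exists_opNorm_le_of_continuous hK (t - max a b) (t - min a b)
  rw [intervalIntegrable_iff] at hφ ⊢
  refine (hφ.norm.const_mul M).mono' (aestronglyMeasurable_volterra hK hφ.aestronglyMeasurable t) ?_
  filter_upwards [ae_restrict_mem measurableSet_uIoc] with s hs
  refine (K (t - s)).le_of_opNorm_le (hM _ ?_) _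
  have : s ∈ Ioc (min a b) (max a b) := hs
  exact ⟨by linarith [this.2], by linarith [this.1]⟩

theorem continuous_volterra {K : ℝ → Y →L[ℝ] X}
    (hK : Continuous fun p : ℝ × Y => K p.1 p.2) {φ : ℝ → Y}
    (hφ : ∀ a b, IntervalIntegrable φ volume a b) :
    Continuous fun t => ∫ s in (0 : ℝ)..t, K (t - s) (φ s) := by
  rw [continuous_iff_continuousAt]
  intro t₀
  set R := |t₀| + 1 with hR
  have hR0 : 0 < R := by positivity
  obtain ⟨M, hM0, hM⟩ := exists_opNorm_le_of_continuous hK (-(2 * R)) (2 * R)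
  have h := intervalIntegral.continuousAt_parametric_primitive_of_dominated
    (μ := volume) (F := fun t s => K (t - s) (φ s)) (fun s => M * ‖φ s‖) (-R) R
    (a₀ := 0) (b₀ := t₀) (x₀ := t₀)
    (fun t => aestronglyMeasurable_volterra hK
      (intervalIntegrable_iff.1 (hφ (-R) R)).aestronglyMeasurable t)
    (by
      have hnhds : Ioo (-R) R ∈ 𝓝 t₀ := by
        refine Ioo_mem_nhds ?_ ?_
        · linarith [neg_abs_le t₀]
        · linarith [le_abs_self t₀]
      filter_upwards [hnhds] with t ht
      filter_upwards [ae_restrict_mem measurableSet_uIoc] with s hs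
      rw [uIoc_of_le (by linarith)] at hs
      refine (K (t - s)).le_of_opNorm_le (hM _ ⟨?_, ?_⟩) _
      · linarith [hs.2, ht.1]
      · linarith [hs.1, ht.2])
    ((hφ (-R) R).norm.const_mul M)
    (ae_of_all _ fun s => (hK.comp
      ((continuous_id.sub continuous_const).prodMk continuous_const)).continuousAt)
    ⟨by linarith, hR0⟩ ⟨by linarith [neg_abs_le t₀], by linarith [le_abs_self t₀]⟩ (by simp)
  -- `t` is both the parameter and the endpoint, so joint continuity is restricted to the diagonal.
  exact ContinuousAt.comp (f := fun t : ℝ => (t, t)) h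
    (continuous_id.prodMk continuous_id).continuousAt

end Volterra

/-! ### The Riemann-Liouville integral of continuous functions -/

theorem ContinuousOn.continuous_comp_max {X : Type*} [TopologicalSpace X] {u : ℝ → X}
    (hu : ContinuousOn u (Ici 0)) :
    Continuous fun t => u (max t 0) :=
  hu.comp_continuous (continuous_id.max continuous_const) fun t => le_max_right t 0

section FracIntegral

variable {X : Type*} [NormedAddCommGroup X] [NormedSpace ℝ X]

theorem fracIntegral_congr {γ t : ℝ} (ht : 0 ≤ t) {u w : ℝ → X} (h : EqOn u w (Ici 0)) :
    fracIntegral γ u t = fracIntegral γ w t := by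
  refine intervalIntegral.integral_congr fun s hs => ?_
  rw [uIcc_of_le ht] at hs
  simp only [h (mem_Ici.2 hs.1)]

theorem intervalIntegrable_fracKernel_smul {γ t : ℝ} (hγ : 0 < γ) (ht : 0 ≤ t) {u : ℝ → X}
    (hu : ContinuousOn u (Ici 0)) :
    IntervalIntegrable (fun s => fracKernel γ (t - s) • u s) volume 0 t :=
  (intervalIntegrable_fracKernel_sub hγ t 0 t).smul_continuousOn
    (hu.mono (by rw [uIcc_of_le ht]; exact Icc_subset_Ici_self))

theorem fracIntegral_zero_right (γ : ℝ) (u : ℝ → X) : fracIntegral γ u 0 = 0 := by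
  simp [fracIntegral]

theorem fracIntegral_add {γ t : ℝ} (hγ : 0 < γ) (ht : 0 ≤ t) {u w : ℝ → X}
    (hu : ContinuousOn u (Ici 0)) (hw : ContinuousOn w (Ici 0)) :
    fracIntegral γ (fun s => u s + w s) t = fracIntegral γ u t + fracIntegral γ w t := by
  simp only [fracIntegral, smul_add]
  exact intervalIntegral.integral_add (intervalIntegrable_fracKernel_smul hγ ht hu)
    (intervalIntegrable_fracKernel_smul hγ ht hw)

theorem fracIntegral_sub {γ t : ℝ} (hγ : 0 < γ) (ht : 0 ≤ t) {u w : ℝ → X}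
    (hu : ContinuousOn u (Ici 0)) (hw : ContinuousOn w (Ici 0)) :
    fracIntegral γ (fun s => u s - w s) t = fracIntegral γ u t - fracIntegral γ w t := by
  simp only [fracIntegral, smul_sub]
  exact intervalIntegral.integral_sub (intervalIntegrable_fracKernel_smul hγ ht hu)
    (intervalIntegrable_fracKernel_smul hγ ht hw)

theorem fracIntegral_smul (γ t c : ℝ) (u : ℝ → X) :
    fracIntegral γ (fun s => c • u s) t = c • fracIntegral γ u t := by
  simp only [fracIntegral, ← intervalIntegral.integral_smul]
  exact intervalIntegral.integral_congr fun s _ => smul_comm _ _ _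

theorem fracIntegral_neg (γ t : ℝ) (u : ℝ → X) :
    fracIntegral γ (fun s => -u s) t = -fracIntegral γ u t := by
  simp [fracIntegral]

theorem fracIntegral_const [CompleteSpace X] {γ t : ℝ} (hγ : 0 < γ) (ht : 0 ≤ t) (x : X) :
    fracIntegral γ (fun _ => x) t = (t ^ γ / Real.Gamma (γ + 1)) • x := by
  rw [fracIntegral, intervalIntegral.integral_smul_const, integral_fracKernel_sub hγ ht]

theorem norm_fracIntegral_le {γ t C : ℝ} (hγ : 0 < γ) (ht : 0 ≤ t) {u : ℝ → X}
    (hC : ∀ s ∈ Icc 0 t, ‖u s‖ ≤ C) :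
    ‖fracIntegral γ u t‖ ≤ t ^ γ / Real.Gamma (γ + 1) * C := by
  rw [← integral_fracKernel_sub hγ ht, ← intervalIntegral.integral_mul_const]
  refine intervalIntegral.norm_integral_le_of_norm_le ht (ae_of_all _ fun s hs => ?_)
    ((intervalIntegrable_fracKernel_sub hγ t 0 t).mul_const C)
  rw [norm_smul, Real.norm_of_nonneg (fracKernel_nonneg hγ _)]
  exact mul_le_mul_of_nonneg_left (hC s (Ioc_subset_Icc_self hs)) (fracKernel_nonneg hγ _)

theorem tendsto_fracIntegral {ι : Type*} {l : Filter ι} {γ t : ℝ} (hγ : 0 < γ) (ht : 0 ≤ t)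
    {u : ι → ℝ → X} {w : ℝ → X} (hu : ∀ i, ContinuousOn (u i) (Ici 0))
    (hw : ContinuousOn w (Ici 0)) (h : TendstoUniformlyOn u w l (Icc 0 t)) :
    Tendsto (fun i => fracIntegral γ (u i) t) l (𝓝 (fracIntegral γ w t)) := by
  rw [Metric.tendsto_nhds]
  intro ε hε
  set c := t ^ γ / Real.Gamma (γ + 1) with hc
  have hc0 : 0 ≤ c :=
    div_nonneg (Real.rpow_nonneg ht _) (Real.Gamma_pos_of_pos (by linarith)).le
  rw [Metric.tendstoUniformlyOn_iff] at h
  -- `c + 1` in place of `c`, which vanishes at `t = 0`.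
  filter_upwards [h (ε / (c + 1)) (by positivity)] with i hi
  rw [dist_eq_norm, ← fracIntegral_sub hγ ht (hu i) hw]
  calc _ ≤ c * (ε / (c + 1)) := norm_fracIntegral_le hγ ht fun s hs => by
          rw [← dist_eq_norm, dist_comm]
          exact (hi s hs).le
    _ < (c + 1) * (ε / (c + 1)) := by
          apply mul_lt_mul_of_pos_right (by linarith) (by positivity)
    _ = ε := by field_simp

theorem continuousOn_fracIntegral {γ : ℝ} (hγ : 0 < γ) {u : ℝ → X}
    (hu : ContinuousOn u (Ici 0)) : ContinuousOn (fracIntegral γ u) (Ici 0) := by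
  -- The roles are swapped: `u` becomes the continuous operator family and the singular kernel the
  -- integrable density; the reflection `s ↦ t - s` restores the original form.
  have hK : Continuous fun p : ℝ × ℝ =>
      (ContinuousLinearMap.toSpanSingleton ℝ (u (max p.1 0))) p.2 := by
    simp only [ContinuousLinearMap.toSpanSingleton_apply]
    exact continuous_snd.smul (hu.continuous_comp_max.comp continuous_fst)
  have h := continuous_volterra (K := fun τ => ContinuousLinearMap.toSpanSingleton ℝ (u (max τ 0)))
    hK (intervalIntegrable_fracKernel hγ)
  refine h.continuousOn.congr fun t ht => ?_
  have h1 := intervalIntegral.integral_comp_sub_left (a := 0) (b := t)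
    (fun s => fracKernel γ s • u (max (t - s) 0)) t
  simp only [sub_sub_cancel, sub_self, sub_zero] at h1
  simp only [ContinuousLinearMap.toSpanSingleton_apply]
  rw [← h1, fracIntegral]
  refine intervalIntegral.integral_congr fun s hs => ?_
  rw [uIcc_of_le ht] at hs
  simp only [max_eq_left hs.1]

/-- The kernel's vanishing encodes the upper limit and the indicator the lower one, so Fubini can be
applied on the whole plane instead of a triangle. -/
theorem fracIntegral_eq_integral {γ t : ℝ} (ht : 0 ≤ t) (u : ℝ → X) :
    fracIntegral γ u t = ∫ s, fracKernel γ (t - s) • (Ioi (0 : ℝ)).indicator u s := by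
  rw [fracIntegral, intervalIntegral.integral_of_le ht, ← integral_indicator measurableSet_Ioc]
  congr 1
  ext s
  by_cases hs : s ∈ Ioc 0 t
  · rw [indicator_of_mem hs, indicator_of_mem (mem_Ioi.2 hs.1)]
  · rw [indicator_of_notMem hs]
    by_cases h0 : 0 < s
    · have : t < s := by
        by_contra hc
        exact hs ⟨h0, not_lt.1 hc⟩
      rw [fracKernel_of_nonpos γ (by linarith), zero_smul]
    · rw [indicator_of_notMem (by simpa using h0), smul_zero]

/-- The semigroup property `J^a J^b = J^(a+b)` on continuous functions. -/
theorem fracIntegral_fracIntegral [CompleteSpace X] {a b t : ℝ} (ha : 0 < a) (hb : 0 < b)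
    (ht : 0 ≤ t) {u : ℝ → X} (hu : ContinuousOn u (Ici 0)) :
    fracIntegral a (fracIntegral b u) t = fracIntegral (a + b) u t := by
  set v : ℝ → X := (Ioi (0 : ℝ)).indicator u with hv
  set F : ℝ → ℝ → X := fun s r => (fracKernel a (t - s) * fracKernel b (s - r)) • v r with hF
  have hint : Integrable (Function.uncurry F) (volume.prod volume) := by
    set ga : ℝ → ℝ := (Ioc 0 t).indicator (fracKernel a)
    set gb : ℝ → ℝ := (Ioc 0 t).indicator (fracKernel b)
    have hga : Integrable ga := by
      rw [integrable_indicator_iff measurableSet_Ioc]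
      exact (intervalIntegrable_iff_integrableOn_Ioc_of_le ht).1 (intervalIntegrable_fracKernel ha 0 t)
    have hgb : Integrable gb := by
      rw [integrable_indicator_iff measurableSet_Ioc]
      exact (intervalIntegrable_iff_integrableOn_Ioc_of_le ht).1 (intervalIntegrable_fracKernel hb 0 t)
    -- The dominating function is the convolution integrand of the truncated kernels, brought to the
    -- form `ga (t - s) * gb (s - r)` by reflecting both variables and swapping them.
    have h1 := hga.convolution_integrand (ContinuousLinearMap.mul ℝ ℝ) hgb
    have hmp : MeasurePreserving (fun p : ℝ × ℝ => (t - p.1, t - p.2))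
        (volume.prod volume) (volume.prod volume) :=
      (Measure.measurePreserving_sub_left volume t).prod (Measure.measurePreserving_sub_left volume t)
    have h2 := (hmp.integrable_comp h1.aestronglyMeasurable).2 h1
    have h3 : Integrable (fun p : ℝ × ℝ => ga (t - p.1) * gb (p.1 - p.2))
        (volume.prod volume) := by
      have := h2.swap
      refine this.congr (ae_of_all _ fun p => ?_)
      simp only [Function.comp, Prod.swap, ContinuousLinearMap.mul_apply']
      congr 2
      ring
    obtain ⟨C, hC⟩ := isCompact_Icc.exists_bound_of_continuousOn
      (hu.mono (Icc_subset_Ici_self : Icc 0 t ⊆ Ici 0))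
    refine (h3.norm.mul_const C).mono' ?_ (ae_of_all _ ?_)
    · have hv' : v = (Ioi (0 : ℝ)).indicator fun s => u (max s 0) := by
        ext s
        by_cases hs : s ∈ Ioi (0 : ℝ)
        · rw [hv, indicator_of_mem hs, indicator_of_mem hs, max_eq_left (le_of_lt hs)]
        · rw [hv, indicator_of_notMem hs, indicator_of_notMem hs]
      have hvm : StronglyMeasurable v := by
        rw [hv']
        exact hu.continuous_comp_max.stronglyMeasurable.indicator measurableSet_Ioi
      have hm : Measurable fun p : ℝ × ℝ => fracKernel a (t - p.1) * fracKernel b (p.1 - p.2) :=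
        ((measurable_fracKernel a).comp (measurable_const.sub measurable_fst)).mul
          ((measurable_fracKernel b).comp (measurable_fst.sub measurable_snd))
      exact (hm.stronglyMeasurable.smul (hvm.comp_measurable measurable_snd)).aestronglyMeasurable
    · rintro ⟨s, r⟩
      simp only [Function.uncurry, hF]
      by_cases h0 : 0 < r ∧ r < s ∧ s < t
      · obtain ⟨hr, hrs, hst⟩ := h0
        rw [norm_smul, show ga (t - s) = fracKernel a (t - s) from
            indicator_of_mem (mem_Ioc.2 ⟨by linarith, by linarith⟩) _,
          show gb (s - r) = fracKernel b (s - r) from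
            indicator_of_mem (mem_Ioc.2 ⟨by linarith, by linarith⟩) _,
          show v r = u r from indicator_of_mem (mem_Ioi.2 hr) _]
        exact mul_le_mul_of_nonneg_left (hC r ⟨hr.le, by linarith⟩) (norm_nonneg _)
      · have hz : (fracKernel a (t - s) * fracKernel b (s - r)) • v r = 0 := by
          by_cases hr : 0 < r
          · by_cases hrs : r < s
            · have hst : t - s ≤ 0 := by
                by_contra hc
                exact h0 ⟨hr, hrs, by linarith⟩
              rw [fracKernel_of_nonpos a hst, zero_mul, zero_smul]
            · rw [fracKernel_of_nonpos b (by linarith), mul_zero, zero_smul]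
          · rw [show v r = 0 from indicator_of_notMem (by simpa using hr) _, smul_zero]
        rw [hz, norm_zero]
        exact mul_nonneg (norm_nonneg _) ((norm_nonneg _).trans (hC 0 ⟨le_rfl, ht⟩))
  have hswap := integral_integral_swap hint
  have hl : ∫ s, ∫ r, F s r = fracIntegral a (fracIntegral b u) t := by
    rw [fracIntegral_eq_integral ht]
    congr 1
    ext s
    simp only [hF, mul_smul]
    rw [integral_smul]
    rcases le_or_gt s 0 with hs | hs
    · have : ∀ r, fracKernel b (s - r) • v r = 0 := by
        intro r
        by_cases hr : 0 < r
        · rw [fracKernel_of_nonpos b (by linarith), zero_smul]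
        · rw [show v r = 0 from indicator_of_notMem (by simpa using hr) _, smul_zero]
      rw [indicator_of_notMem (by simpa using hs)]
      simp [this]
    · rw [indicator_of_mem (mem_Ioi.2 hs), fracIntegral_eq_integral hs.le]
  have hr : ∫ r, ∫ s, F s r = fracIntegral (a + b) u t := by
    rw [fracIntegral_eq_integral ht]
    congr 1
    ext r
    simp only [hF]
    rw [integral_smul_const, integral_fracKernel_mul_fracKernel ha hb]
  rw [← hl, ← hr, hswap]

end FracIntegral

/-! ### Closed subspaces and Bochner integrals -/

/-- The quotient map by the closed subspace commutes with the integral and kills the integrand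
almost everywhere. -/
theorem Submodule.integral_mem_of_isClosed {Ω Z : Type*} [MeasurableSpace Ω] {μ : Measure Ω}
    [NormedAddCommGroup Z] [NormedSpace ℝ Z] [CompleteSpace Z] (G : Submodule ℝ Z)
    (hG : IsClosed (G : Set Z)) {h : Ω → Z} (hint : Integrable h μ) (hmem : ∀ᵐ s ∂μ, h s ∈ G) :
    ∫ s, h s ∂μ ∈ G := by
  have : IsClosed (G : Set Z) := hG
  have h1 := G.mkQL.integral_comp_comm hint
  have h2 : ∫ s, G.mkQL (h s) ∂μ = 0 := by
    refine integral_eq_zero_of_ae ?_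
    filter_upwards [hmem] with s hs
    simpa using hs
  rw [h2] at h1
  have h3 := h1.symm
  rw [Submodule.mkQL_apply, Submodule.mkQ_apply, Submodule.Quotient.mk_eq_zero] at h3
  exact h3

/-- Applied to the graph of a closed operator, this is Hille's theorem: the operator may be taken
inside the integral. -/
theorem Submodule.intervalIntegral_prodMk_mem {X Y : Type*} [NormedAddCommGroup X]
    [NormedSpace ℝ X] [CompleteSpace X] [NormedAddCommGroup Y] [NormedSpace ℝ Y] [CompleteSpace Y]
    (G : Submodule ℝ (X × Y)) (hG : IsClosed (G : Set (X × Y))) {t : ℝ} (ht : 0 ≤ t)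
    {h : ℝ → X} {k : ℝ → Y} (hh : IntervalIntegrable h volume 0 t)
    (hk : IntervalIntegrable k volume 0 t) (hmem : ∀ s ∈ Ioc 0 t, (h s, k s) ∈ G) :
    (∫ s in (0 : ℝ)..t, h s, ∫ s in (0 : ℝ)..t, k s) ∈ G := by
  rw [intervalIntegrable_iff_integrableOn_Ioc_of_le ht] at hh hk
  rw [intervalIntegral.integral_of_le ht, intervalIntegral.integral_of_le ht, ← integral_pair hh hk]
  refine G.integral_mem_of_isClosed hG (hh.prodMk hk) ?_
  filter_upwards [ae_restrict_mem measurableSet_Ioc] with s hs using hmem s hs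

/-! ### Solutions in terms of graphs -/

section Solutions

variable {𝕜 X : Type*} [RCLike 𝕜] [NormedAddCommGroup X] [NormedSpace ℝ X]
  [NormedSpace 𝕜 X]

theorem LinearPMap.mk_mem_graph_iff {𝕜 X : Type*} [RCLike 𝕜] [AddCommGroup X] [Module 𝕜 X]
    {A : X →ₗ.[𝕜] X} {x y : X} :
    (x, y) ∈ A.graph ↔ ∃ h : x ∈ A.domain, y = A ⟨x, h⟩ := by
  rw [LinearPMap.mem_graph_iff]
  constructor
  · rintro ⟨⟨z, hz⟩, rfl, h⟩
    exact ⟨hz, h.symm⟩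
  · rintro ⟨h, rfl⟩
    exact ⟨⟨x, h⟩, rfl, rfl⟩

theorem LinearPMap.mk_mem_neg_graph_iff {𝕜 X : Type*} [RCLike 𝕜] [AddCommGroup X] [Module 𝕜 X]
    {A : X →ₗ.[𝕜] X} {x y : X} :
    (x, y) ∈ (-A).graph ↔ (x, -y) ∈ A.graph := by
  rw [LinearPMap.mk_mem_graph_iff, LinearPMap.mk_mem_graph_iff]
  simp only [LinearPMap.neg_apply, LinearPMap.neg_domain]
  constructor
  · rintro ⟨h, rfl⟩
    exact ⟨h, neg_neg _⟩
  · rintro ⟨h, h2⟩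
    exact ⟨h, by rw [← neg_eq_iff_eq_neg]; exact h2⟩

theorem LinearPMap.IsClosed.neg {𝕜 X : Type*} [RCLike 𝕜] [NormedAddCommGroup X]
    [NormedSpace 𝕜 X] {A : X →ₗ.[𝕜] X} (hA : A.IsClosed) : (-A).IsClosed := by
  have : ((-A).graph : Set (X × X)) = (fun p : X × X => (p.1, -p.2)) ⁻¹' (A.graph : Set (X × X)) := by
    ext ⟨x, y⟩
    exact LinearPMap.mk_mem_neg_graph_iff
  rw [LinearPMap.IsClosed, this]
  exact IsClosed.preimage (by fun_prop) hA

theorem mk_mem_graph_operatorSq_iff {𝕜 X : Type*} [RCLike 𝕜] [AddCommGroup X] [Module 𝕜 X]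
    {A : X →ₗ.[𝕜] X} {x z : X} :
    (x, z) ∈ (operatorSq A).graph ↔ ∃ y, (x, y) ∈ A.graph ∧ (y, z) ∈ A.graph := by
  simp only [LinearPMap.mk_mem_graph_iff]
  constructor
  · rintro ⟨h, rfl⟩
    obtain ⟨h1, h2⟩ := (mem_operatorSq_domain A x).1 h
    exact ⟨A ⟨x, h1⟩, ⟨h1, rfl⟩, h2, rfl⟩
  · rintro ⟨y, ⟨h1, rfl⟩, h2, rfl⟩
    exact ⟨(mem_operatorSq_domain A x).2 ⟨h1, h2⟩, rfl⟩

/-- In graph form, linearity and limits of solutions reduce to the graph being a closed subspace. -/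
theorem isMildSolution_iff {γ : ℝ} {B : X →ₗ.[𝕜] X} {f u : ℝ → X} :
    IsMildSolution γ B f u ↔ ContinuousOn u (Ici 0) ∧
      ∀ t, 0 ≤ t → (fracIntegral γ u t, u t - f t) ∈ B.graph := by
  simp only [IsMildSolution, LinearPMap.mk_mem_graph_iff, sub_eq_iff_eq_add']

theorem IsMildSolution.mem_graph {γ : ℝ} {B : X →ₗ.[𝕜] X} {f u : ℝ → X}
    (h : IsMildSolution γ B f u) {t : ℝ} (ht : 0 ≤ t) :
    (fracIntegral γ u t, u t - f t) ∈ B.graph :=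
  (isMildSolution_iff.1 h).2 t ht

theorem isStrongSolution_of_continuousOn {γ : ℝ} (hγ : 0 < γ) {B : X →ₗ.[𝕜] X} {f u v : ℝ → X}
    (hu : ContinuousOn u (Ici 0)) (hv : ContinuousOn v (Ici 0))
    (huv : ∀ t, 0 ≤ t → (u t, v t) ∈ B.graph)
    (heq : ∀ t, 0 ≤ t → u t = f t + fracIntegral γ v t) : IsStrongSolution γ B f u :=
  ⟨hu, v, fun t ht => LinearPMap.mk_mem_graph_iff.1 (huv t ht),
    fun t ht => ⟨intervalIntegrable_fracKernel_smul hγ ht hv, heq t ht⟩⟩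

theorem IsMildSolution.add {γ : ℝ} (hγ : 0 < γ) {B : X →ₗ.[𝕜] X} {f g u w : ℝ → X}
    (hu : IsMildSolution γ B f u) (hw : IsMildSolution γ B g w) :
    IsMildSolution γ B (fun t => f t + g t) (fun t => u t + w t) := by
  refine isMildSolution_iff.2 ⟨hu.1.add hw.1, fun t ht => ?_⟩
  rw [fracIntegral_add hγ ht hu.1 hw.1, add_sub_add_comm]
  exact B.graph.add_mem (hu.mem_graph ht) (hw.mem_graph ht)

theorem IsMildSolution.sub {γ : ℝ} (hγ : 0 < γ) {B : X →ₗ.[𝕜] X} {f g u w : ℝ → X}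
    (hu : IsMildSolution γ B f u) (hw : IsMildSolution γ B g w) :
    IsMildSolution γ B (fun t => f t - g t) (fun t => u t - w t) := by
  refine isMildSolution_iff.2 ⟨hu.1.sub hw.1, fun t ht => ?_⟩
  rw [fracIntegral_sub hγ ht hu.1 hw.1, sub_sub_sub_comm]
  exact B.graph.sub_mem (hu.mem_graph ht) (hw.mem_graph ht)

/-- One integration upgrades mild to strong: `B (J^γ w) = w`, so `J^γ w` is a strong solution with
zero datum. It vanishes, and then so does its image `w`. -/
theorem IsWellPosed.eqOn_zero_of_mild {γ : ℝ} (hγ : 0 < γ) {B : X →ₗ.[𝕜] X}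
    (hB : IsWellPosed γ B) {w : ℝ → X} (hw : IsMildSolution γ B (fun _ => 0) w) :
    EqOn w 0 (Ici 0) := by
  have hmem : ∀ t, 0 ≤ t → (fracIntegral γ w t, w t) ∈ B.graph := fun t ht => by
    simpa using hw.mem_graph ht
  have h1 : IsStrongSolution γ B (fun _ => 0) (fracIntegral γ w) :=
    isStrongSolution_of_continuousOn hγ (continuousOn_fracIntegral hγ hw.1) hw.1 hmem
      fun t _ => (zero_add _).symm
  have h2 : IsStrongSolution γ B (fun _ => 0) (fun _ => 0) :=
    isStrongSolution_of_continuousOn hγ (v := fun _ => 0) continuousOn_const continuousOn_const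
      (fun t _ => B.graph.zero_mem) fun t _ => by simp [fracIntegral]
  intro t ht
  have h3 : fracIntegral γ w t = 0 := hB.unique_strong 0 B.domain.zero_mem _ _ h1 h2 ht
  exact B.graph_fst_eq_zero_snd (hmem t ht) h3

theorem IsWellPosed.eqOn_of_mild {γ : ℝ} (hγ : 0 < γ) {B : X →ₗ.[𝕜] X}
    (hB : IsWellPosed γ B) {f u w : ℝ → X} (hu : IsMildSolution γ B f u)
    (hw : IsMildSolution γ B f w) : EqOn u w (Ici 0) := by
  have h := hu.sub hγ hw
  simp only [sub_self] at h
  intro t ht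
  exact sub_eq_zero.1 (hB.eqOn_zero_of_mild hγ h ht)

variable [IsScalarTower ℝ 𝕜 X]

theorem LinearPMap.real_smul_mem_graph {A : X →ₗ.[𝕜] X} {x y : X} (h : (x, y) ∈ A.graph) (c : ℝ) :
    (c • x, c • y) ∈ A.graph :=
  (A.graph.restrictScalars ℝ).smul_mem c h

theorem IsMildSolution.smul {γ : ℝ} {B : X →ₗ.[𝕜] X} {f u : ℝ → X}
    (hu : IsMildSolution γ B f u) (c : ℝ) :
    IsMildSolution γ B (fun t => c • f t) (fun t => c • u t) := by
  refine isMildSolution_iff.2 ⟨hu.1.const_smul c, fun t ht => ?_⟩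
  rw [fracIntegral_smul, ← smul_sub]
  exact LinearPMap.real_smul_mem_graph (hu.mem_graph ht) c

variable [CompleteSpace X]

theorem fracIntegral_mem_graph_of_intervalIntegrable {γ t : ℝ} (ht : 0 ≤ t)
    {B : X →ₗ.[𝕜] X} (hB : B.IsClosed) {u v : ℝ → X}
    (hu : IntervalIntegrable (fun s => fracKernel γ (t - s) • u s) volume 0 t)
    (hv : IntervalIntegrable (fun s => fracKernel γ (t - s) • v s) volume 0 t)
    (huv : ∀ s, 0 ≤ s → (u s, v s) ∈ B.graph) :
    (fracIntegral γ u t, fracIntegral γ v t) ∈ B.graph :=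
  (B.graph.restrictScalars ℝ).intervalIntegral_prodMk_mem hB ht hu hv fun s hs =>
    LinearPMap.real_smul_mem_graph (huv s hs.1.le) _

theorem fracIntegral_mem_graph {γ t : ℝ} (hγ : 0 < γ) (ht : 0 ≤ t)
    {B : X →ₗ.[𝕜] X} (hB : B.IsClosed) {u v : ℝ → X} (hu : ContinuousOn u (Ici 0))
    (hv : ContinuousOn v (Ici 0)) (huv : ∀ s, 0 ≤ s → (u s, v s) ∈ B.graph) :
    (fracIntegral γ u t, fracIntegral γ v t) ∈ B.graph :=
  fracIntegral_mem_graph_of_intervalIntegrable ht hB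
    (intervalIntegrable_fracKernel_smul hγ ht hu) (intervalIntegrable_fracKernel_smul hγ ht hv) huv

theorem IsStrongSolution.isMildSolution {γ : ℝ} (hγ : 0 < γ) {B : X →ₗ.[𝕜] X} (hB : B.IsClosed)
    {f u : ℝ → X} (h : IsStrongSolution γ B f u) : IsMildSolution γ B f u := by
  obtain ⟨hu, v, hv, heq⟩ := h
  refine isMildSolution_iff.2 ⟨hu, fun t ht => ?_⟩
  rw [(heq t ht).2, add_sub_cancel_left]
  exact fracIntegral_mem_graph_of_intervalIntegrable ht hB
    (intervalIntegrable_fracKernel_smul hγ ht hu) (heq t ht).1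
    fun s hs => LinearPMap.mk_mem_graph_iff.2 (hv s hs)

end Solutions

/-! ### The resolvent family -/

section Resolvent

theorem continuous_fracIntegral_apply {X Y : Type*} [NormedAddCommGroup X] [NormedSpace ℝ X]
    [NormedAddCommGroup Y] [NormedSpace ℝ Y] {S : ℝ → Y →L[ℝ] X}
    (hS : Continuous fun p : ℝ × Y => S p.1 p.2) {γ t : ℝ} (hγ : 0 < γ) (ht : 0 ≤ t) :
    Continuous fun y => fracIntegral γ (fun s => S s y) t := by
  have hc : ∀ y, Continuous fun s => S s y := fun y =>
    hS.comp (continuous_id.prodMk continuous_const)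
  obtain ⟨M, hM0, hM⟩ := exists_opNorm_le_of_continuous hS 0 t
  rw [continuous_iff_continuousAt]
  intro y₀
  refine tendsto_fracIntegral hγ ht (fun y => (hc y).continuousOn) (hc y₀).continuousOn ?_
  rw [Metric.tendstoUniformlyOn_iff]
  intro ε hε
  filter_upwards [Metric.ball_mem_nhds y₀ (show 0 < ε / (M + 1) by positivity)] with y hy s hs
  rw [dist_eq_norm, ← map_sub]
  rw [mem_ball_iff_norm'] at hy
  calc _ ≤ M * ‖y₀ - y‖ := (S s).le_of_opNorm_le (hM s hs) _
    _ ≤ (M + 1) * ‖y₀ - y‖ := by gcongr; linarith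
    _ < (M + 1) * (ε / (M + 1)) := by gcongr
    _ = ε := by field_simp

/-- `S` is a resolvent family for the Volterra equation of order `γ` with operator `B`. -/
structure IsResolvent {𝕜 X : Type*} [RCLike 𝕜] [NormedAddCommGroup X] [NormedSpace ℝ X]
    [NormedSpace 𝕜 X] (γ : ℝ) (B : X →ₗ.[𝕜] X) (S : ℝ → X →L[ℝ] X) : Prop where
  continuous_uncurry : Continuous fun p : ℝ × X => S p.1 p.2
  isMildSolution : ∀ x, IsMildSolution γ B (fun _ => x) fun t => S t x
  mem_graph : ∀ x y, (x, y) ∈ B.graph → ∀ t, 0 ≤ t → (S t x, S t y) ∈ B.graph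
  eq_add_fracIntegral : ∀ x y, (x, y) ∈ B.graph → ∀ t, 0 ≤ t →
    S t x = x + fracIntegral γ (fun s => S s y) t

variable {𝕜 X : Type*} [RCLike 𝕜] [NormedAddCommGroup X] [NormedSpace ℝ X]
  [NormedSpace 𝕜 X]

theorem IsResolvent.continuous {γ : ℝ} {B : X →ₗ.[𝕜] X} {S : ℝ → X →L[ℝ] X}
    (hS : IsResolvent γ B S) (x : X) : Continuous fun t => S t x :=
  hS.continuous_uncurry.comp (continuous_id.prodMk continuous_const)

/-- A strongly continuous (on a dense set) and locally bounded operator family is jointly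
continuous. -/
theorem continuous_uncurry_of_dense {Y : Type*} [NormedAddCommGroup Y] [NormedSpace ℝ Y]
    {S : ℝ → Y →L[ℝ] X} {D : Set Y}
    (hD : Dense D) (hc : ∀ x ∈ D, Continuous fun t => S t x)
    (hb : ∀ T, ∃ M, ∀ t ≤ T, ‖S t‖ ≤ M) : Continuous fun p : ℝ × Y => S p.1 p.2 := by
  rw [continuous_iff_continuousAt]
  rintro ⟨t₀, x₀⟩
  obtain ⟨M, hM⟩ := hb (t₀ + 1)
  have hM0 : 0 ≤ M := (norm_nonneg _).trans (hM t₀ (by linarith))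
  rw [Metric.continuousAt_iff']
  intro ε hε
  have hδ : 0 < ε / (4 * (M + 1)) := by positivity
  obtain ⟨d, hdD, hd⟩ := Metric.dense_iff.1 hD x₀ (ε / (4 * (M + 1))) hδ
  rw [mem_ball_iff_norm] at hdD
  have h1 : ∀ᶠ p : ℝ × Y in 𝓝 (t₀, x₀), p.1 < t₀ + 1 :=
    continuous_fst.continuousAt.eventually (gt_mem_nhds (by simp))
  have h2 : ∀ᶠ p : ℝ × Y in 𝓝 (t₀, x₀), ‖p.2 - x₀‖ < ε / (4 * (M + 1)) := by
    have := (continuous_snd (X := ℝ) (Y := Y)).continuousAt (x := (t₀, x₀))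
      (Metric.ball_mem_nhds x₀ hδ)
    filter_upwards [this] with p hp
    exact mem_ball_iff_norm.1 hp
  have h3 : ∀ᶠ p : ℝ × Y in 𝓝 (t₀, x₀), ‖S p.1 d - S t₀ d‖ < ε / 4 := by
    have := (((hc d hd).comp continuous_fst).continuousAt (x := (t₀, x₀))).eventually
      (Metric.ball_mem_nhds (S t₀ d) (show 0 < ε / 4 by positivity))
    filter_upwards [this] with p hp
    exact mem_ball_iff_norm.1 hp
  filter_upwards [h1, h2, h3] with p hp1 hp2 hp3
  rw [dist_eq_norm]
  have e : S p.1 p.2 - S t₀ x₀ = S p.1 (p.2 - x₀) + (S p.1 (x₀ - d) + (S p.1 d - S t₀ d)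
      + S t₀ (d - x₀)) := by
    simp only [map_sub]
    abel
  have hq : M * (ε / (4 * (M + 1))) ≤ ε / 4 := by
    rw [mul_div_assoc', div_le_div_iff₀ (by positivity) (by norm_num)]
    nlinarith
  have k1 : ‖S p.1 (p.2 - x₀)‖ ≤ ε / 4 :=
    ((S p.1).le_of_opNorm_le (hM _ hp1.le) _).trans
      ((mul_le_mul_of_nonneg_left hp2.le hM0).trans hq)
  have k2 : ‖S p.1 (x₀ - d)‖ ≤ ε / 4 :=
    ((S p.1).le_of_opNorm_le (hM _ hp1.le) _).trans
      ((mul_le_mul_of_nonneg_left (by rw [norm_sub_rev]; exact hdD.le) hM0).trans hq)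
  have k3 : ‖S t₀ (d - x₀)‖ ≤ ε / 4 :=
    ((S t₀).le_of_opNorm_le (hM _ (by linarith)) _).trans
      ((mul_le_mul_of_nonneg_left hdD.le hM0).trans hq)
  rw [e]
  have n1 := norm_add_le (S p.1 (p.2 - x₀)) (S p.1 (x₀ - d) + (S p.1 d - S t₀ d) + S t₀ (d - x₀))
  have n2 := norm_add₃_le (a := S p.1 (x₀ - d)) (b := S p.1 d - S t₀ d) (c := S t₀ (d - x₀))
  linarith

variable [IsScalarTower ℝ 𝕜 X] [CompleteSpace X]

/-- Uniqueness makes the solution operators linear on `D(B)`, continuous dependence makes them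
locally bounded, and density extends them to `X`. Closedness of `B` carries the mild equation to the
extension. -/
theorem IsWellPosed.exists_resolvent {γ : ℝ} (hγ : 0 < γ) {B : X →ₗ.[𝕜] X}
    (hB : IsWellPosed γ B) (hcl : B.IsClosed) (hd : Dense (B.domain : Set X)) :
    ∃ S, IsResolvent γ B S := by
  set D : Submodule ℝ X := B.domain.restrictScalars ℝ with hDdef
  have hex : ∀ x : D, ∃ u, IsStrongSolution γ B (fun _ => (x : X)) u := fun x =>
    hB.exists_strong x x.2
  choose u hu using hex
  have hm : ∀ x : D, IsMildSolution γ B (fun _ => (x : X)) (u x) := fun x =>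
    (hu x).isMildSolution hγ hcl
  -- Freezing negative times at `0` makes the family continuous on all of `ℝ`.
  let T : ℝ → D →ₗ[ℝ] X := fun t =>
    { toFun := fun x => u x (max t 0)
      map_add' := fun x y => hB.eqOn_of_mild hγ (hm (x + y)) ((hm x).add hγ (hm y))
        (mem_Ici.2 (le_max_right t 0))
      map_smul' := fun c x => hB.eqOn_of_mild hγ (hm (c • x)) ((hm x).smul c)
        (mem_Ici.2 (le_max_right t 0)) }
  have hT : ∀ t x, T t x = u x (max t 0) := fun t x => rfl
  have hbound : ∀ R, ∃ M, ∀ t ≤ R, ∀ x : D, ‖T t x‖ ≤ M * ‖(x : X)‖ := by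
    intro R
    -- If no bound holds, normalising the offending data gives `z n → 0` whose solutions have norm
    -- `1` at some time in a fixed compact interval.
    by_contra! hcon
    choose t ht x hx using fun n : ℕ => hcon (n + 1)
    have hpos : ∀ n, 0 < ‖T (t n) (x n)‖ := fun n => lt_of_le_of_lt (by positivity) (hx n)
    set z : ℕ → D := fun n => ‖T (t n) (x n)‖⁻¹ • x n with hz
    have hz0 : Tendsto (fun n => (z n : X)) atTop (𝓝 0) := by
      rw [tendsto_zero_iff_norm_tendsto_zero]
      refine squeeze_zero (fun n => norm_nonneg _) (fun n => ?_)
        (tendsto_one_div_add_atTop_nhds_zero_nat (𝕜 := ℝ))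
      have h1 : ‖(z n : X)‖ = ‖T (t n) (x n)‖⁻¹ * ‖(x n : X)‖ := by
        simp only [hz, Submodule.coe_smul, norm_smul, norm_inv, norm_norm]
      rw [h1, inv_mul_le_iff₀ (hpos n), mul_one_div, le_div_iff₀ (by positivity)]
      linarith [hx n]
    have huni := hB.continuous_dependence (fun n => (z n : X)) (fun n => u (z n))
      (fun n => (z n).2) (fun n => hu (z n)) hz0 (max R 1) (by positivity)
    rw [Metric.tendstoUniformlyOn_iff] at huni
    obtain ⟨n, hn⟩ := (huni 1 one_pos).exists
    have h1 := hn (max (t n) 0) ⟨le_max_right _ _,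
      max_le ((ht n).trans (le_max_left _ _)) (zero_le_one.trans (le_max_right _ _))⟩
    rw [dist_zero_left, ← hT, hz, map_smul, norm_smul, norm_inv, norm_norm,
      inv_mul_cancel₀ (hpos n).ne'] at h1
    exact lt_irrefl _ h1
  have hdense : DenseRange (D.subtypeL : D → X) := by
    have : range (D.subtypeL : D → X) = (B.domain : Set X) := by
      ext x
      simp [D]
    rwa [DenseRange, this]
  let S : ℝ → X →L[ℝ] X := fun t => (T t).extendOfNorm D.subtypeL
  have hST : ∀ t (x : D), S t x = T t x := fun t x =>
    LinearMap.extendOfNorm_eq hdense ((hbound t).imp fun M hM x => hM t le_rfl x) x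
  have hcont : Continuous fun p : ℝ × X => S p.1 p.2 := by
    refine continuous_uncurry_of_dense hd (fun x hx => ?_) fun R => ?_
    · have : (fun t => S t x) = fun t => u ⟨x, hx⟩ (max t 0) := by
        ext t
        exact hST t ⟨x, hx⟩
      rw [this]
      exact (hm ⟨x, hx⟩).1.continuous_comp_max
    · obtain ⟨M, hM⟩ := hbound R
      refine ⟨max M 0, fun t ht => ?_⟩
      refine ContinuousLinearMap.opNorm_le_bound _ (le_max_right _ _) fun x => ?_
      refine (hd.induction (P := fun x => ‖S t x‖ ≤ max M 0 * ‖x‖) (fun x hx => ?_)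
        (isClosed_le (by fun_prop) (by fun_prop)) x)
      rw [hST t ⟨x, hx⟩]
      exact (hM t ht ⟨x, hx⟩).trans
        (mul_le_mul_of_nonneg_right (le_max_left _ _) (norm_nonneg _))
  have hmild : ∀ x, IsMildSolution γ B (fun _ => x) fun t => S t x := by
    intro x
    refine isMildSolution_iff.2
      ⟨(hcont.comp (continuous_id.prodMk continuous_const)).continuousOn, fun t ht => ?_⟩
    refine hd.induction
      (P := fun x => (fracIntegral γ (fun s => S s x) t, S t x - x) ∈ B.graph)
      (fun x hx => ?_) ?_ x
    · have heq : EqOn (fun s => S s x) (u ⟨x, hx⟩) (Ici 0) := fun s hs => by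
        simp only [hST s ⟨x, hx⟩, hT, max_eq_left (mem_Ici.1 hs)]
      rw [fracIntegral_congr ht heq, show S t x = u ⟨x, hx⟩ t from heq ht]
      exact (hm ⟨x, hx⟩).mem_graph ht
    · exact IsClosed.preimage
        ((continuous_fracIntegral_apply hcont hγ ht).prodMk (by fun_prop)) hcl
  -- `B x + B (J^γ S y) = y + (S y - y) = S y`. Hence `x + J^γ S y` is a strong solution with datum
  -- `x`, and uniqueness identifies it with `S x`.
  have key : ∀ x y, (x, y) ∈ B.graph → ∀ t, 0 ≤ t →
      (x + fracIntegral γ (fun s => S s y) t, S t y) ∈ B.graph := by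
    intro x y hxy t ht
    simpa using B.graph.add_mem hxy ((hmild y).mem_graph ht)
  have heq : ∀ x y, (x, y) ∈ B.graph → ∀ t, 0 ≤ t →
      S t x = x + fracIntegral γ (fun s => S s y) t := by
    intro x y hxy t ht
    have hw : IsStrongSolution γ B (fun _ => x) fun t => x + fracIntegral γ (fun s => S s y) t :=
      isStrongSolution_of_continuousOn hγ
        (continuousOn_const.add (continuousOn_fracIntegral hγ (hmild y).1)) (hmild y).1
        (key x y hxy) fun t _ => rfl
    exact hB.eqOn_of_mild hγ (hmild x) (hw.isMildSolution hγ hcl) ht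
  exact ⟨S, hcont, hmild, fun x y hxy t ht => heq x y hxy t ht ▸ key x y hxy t ht, heq⟩

end Resolvent

/-! ### Mild solutions for forcing functions of class `W^{1,1}` -/

section Forcing

/-- The densities for different `T` come from separate choices, so they are glued: on each `[n, n +
1)` the density belonging to `T = n + 1` is used. The constants cancel in increments of `f`. -/
theorem exists_intervalIntegrable_of_memW11 {X : Type*} [NormedAddCommGroup X] [NormedSpace ℝ X]
    {f : ℝ → X} (hf : ∀ T, 0 < T → MemW11 T f) :
    ∃ φ : ℝ → X, (∀ a b, IntervalIntegrable φ volume a b) ∧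
      ∀ t, 0 ≤ t → f t = f 0 + ∫ s in (0 : ℝ)..t, φ s := by
  choose c φ hφ hfφ using fun n : ℕ => hf (n + 1) (by positivity)
  set ψ : ℝ → X := fun s => if 0 < s then φ ⌊s⌋₊ s else 0 with hψ
  have hψφ : ∀ n : ℕ, EqOn (φ n) ψ (Ioo (n : ℝ) (n + 1)) := by
    intro n s hs
    have h0 : 0 < s := lt_of_le_of_lt n.cast_nonneg hs.1
    have hfl : ⌊s⌋₊ = n := (Nat.floor_eq_iff h0.le).2 ⟨hs.1.le, hs.2⟩
    simp only [hψ, if_pos h0, hfl]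
  have hn1 : ∀ n : ℕ, (n : ℝ) ≤ n + 1 := fun n => by linarith
  have hψn : ∀ n : ℕ, IntervalIntegrable ψ volume n (n + 1) := by
    intro n
    rw [intervalIntegrable_iff_integrableOn_Ioo_of_le (hn1 n)]
    exact ((hφ n).mono_set (Ioo_subset_Ioo_left n.cast_nonneg)).congr_fun (hψφ n) measurableSet_Ioo
  have hψ0 : ∀ n : ℕ, IntervalIntegrable ψ volume 0 n := by
    intro n
    induction n with
    | zero => simp
    | succ n ih =>
      push_cast
      exact ih.trans (hψn n)
  have hψneg : ∀ n : ℕ, IntervalIntegrable ψ volume (-n) 0 := by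
    intro n
    rw [intervalIntegrable_iff_integrableOn_Ioc_of_le (by simp)]
    refine (integrableOn_zero (ε' := X)).congr_fun (fun s hs => ?_) measurableSet_Ioc
    simp [hψ, hs.2.not_gt]
  have hint : ∀ a b, IntervalIntegrable ψ volume a b := by
    intro a b
    obtain ⟨n, hn⟩ := exists_nat_ge (max |a| |b|)
    have ha := abs_le.1 ((le_max_left _ _).trans hn)
    have hb := abs_le.1 ((le_max_right _ _).trans hn)
    refine ((hψneg n).trans (hψ0 n)).mono_set ?_
    rw [uIcc_of_le (show -(n : ℝ) ≤ n by linarith [ha.1, ha.2])]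
    exact uIcc_subset_Icc ha hb
  have hstep : ∀ (n : ℕ) (t : ℝ), t ∈ Icc (n : ℝ) (n + 1) →
      f t = f n + ∫ s in (n : ℝ)..t, ψ s := by
    intro n t ht
    have hφint : ∀ x ∈ Icc (0 : ℝ) (n + 1), IntervalIntegrable (φ n) volume 0 x := by
      intro x hx
      rw [intervalIntegrable_iff_integrableOn_Ioo_of_le hx.1]
      exact (hφ n).mono_set (Ioo_subset_Ioo_right hx.2)
    have hnmem : (n : ℝ) ∈ Icc (0 : ℝ) (n + 1) := ⟨n.cast_nonneg, hn1 n⟩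
    have htmem : t ∈ Icc (0 : ℝ) (n + 1) := ⟨n.cast_nonneg.trans ht.1, ht.2⟩
    have h1 : ∫ s in (n : ℝ)..t, ψ s = ∫ s in (n : ℝ)..t, φ n s := by
      rw [intervalIntegral.integral_of_le ht.1, intervalIntegral.integral_of_le ht.1,
        integral_Ioc_eq_integral_Ioo, integral_Ioc_eq_integral_Ioo]
      exact setIntegral_congr_fun measurableSet_Ioo fun s hs =>
        (hψφ n ⟨hs.1, hs.2.trans_le ht.2⟩).symm
    rw [h1, ← intervalIntegral.integral_interval_sub_left (hφint t htmem) (hφint n hnmem),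
      hfφ n t htmem, hfφ n n hnmem]
    abel
  have hnat : ∀ n : ℕ, f n = f 0 + ∫ s in (0 : ℝ)..n, ψ s := by
    intro n
    induction n with
    | zero => simp
    | succ n ih =>
      push_cast
      rw [hstep n (n + 1) ⟨hn1 n, le_rfl⟩, ih, add_assoc,
        intervalIntegral.integral_add_adjacent_intervals (hint _ _) (hint _ _)]
  refine ⟨ψ, hint, fun t ht => ?_⟩
  rw [hstep ⌊t⌋₊ t ⟨Nat.floor_le ht, (Nat.lt_floor_add_one t).le⟩, hnat, add_assoc,
    intervalIntegral.integral_add_adjacent_intervals (hint _ _) (hint _ _)]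

section Fubini

variable {X Y : Type*} [NormedAddCommGroup X] [NormedSpace ℝ X]
  [NormedAddCommGroup Y] [NormedSpace ℝ Y]

/-- `J^γ (K * φ) = (J^γ K) * φ`. -/
theorem fracIntegral_volterra {γ t : ℝ} (hγ : 0 < γ) (ht : 0 ≤ t) {K : ℝ → Y →L[ℝ] X}
    (hK : Continuous fun p : ℝ × Y => K p.1 p.2) {φ : ℝ → Y}
    (hφ : IntervalIntegrable φ volume 0 t) :
    IntervalIntegrable (fun r => fracIntegral γ (fun s => K s (φ r)) (t - r)) volume 0 t ∧
      fracIntegral γ (fun s => ∫ r in (0 : ℝ)..s, K (s - r) (φ r)) t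
        = ∫ r in (0 : ℝ)..t, fracIntegral γ (fun s => K s (φ r)) (t - r) := by
  set v : ℝ → Y := (Ioc 0 t).indicator φ with hv
  have hvint : Integrable v := by
    rw [hv, integrable_indicator_iff measurableSet_Ioc]
    exact (intervalIntegrable_iff_integrableOn_Ioc_of_le ht).1 hφ
  -- The cut-off `r < s` must be explicit: unlike `fracKernel`, `K` need not vanish at negative
  -- times.
  set F : ℝ → ℝ → X := fun s r => if r < s then fracKernel γ (t - s) • K (s - r) (v r) else 0
    with hF
  have hint : Integrable (Function.uncurry F) (volume.prod volume) := by
    obtain ⟨M, hM0, hM⟩ := exists_opNorm_le_of_continuous hK 0 t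
    set g : ℝ → ℝ := (Ioc 0 t).indicator (fracKernel γ) with hg
    have hgint : Integrable g := by
      rw [hg, integrable_indicator_iff measurableSet_Ioc]
      exact (intervalIntegrable_iff_integrableOn_Ioc_of_le ht).1 (intervalIntegrable_fracKernel hγ 0 t)
    refine ((hgint.comp_sub_left t).mul_prod (hvint.norm.const_mul M)).norm.mono' ?_ (ae_of_all _ ?_)
    · have h1 : AEStronglyMeasurable (fun p : ℝ × ℝ => fracKernel γ (t - p.1) • K (p.1 - p.2) (v p.2))
          (volume.prod volume) := by
        refine AEStronglyMeasurable.smul ?_ ?_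
        · exact ((measurable_fracKernel γ).comp
            (measurable_const.sub measurable_fst)).aestronglyMeasurable
        · exact hK.comp_aestronglyMeasurable
            ((continuous_fst.sub continuous_snd).aestronglyMeasurable.prodMk
              hvint.aestronglyMeasurable.comp_snd)
      have h2 : Function.uncurry F = {p : ℝ × ℝ | p.2 < p.1}.indicator
          fun p : ℝ × ℝ => fracKernel γ (t - p.1) • K (p.1 - p.2) (v p.2) := by
        ext ⟨s, r⟩
        simp [hF, indicator]
      rw [h2]
      exact h1.indicator (measurableSet_lt measurable_snd measurable_fst)
    · rintro ⟨s, r⟩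
      simp only [Function.uncurry, hF]
      by_cases h0 : 0 < r ∧ r < s ∧ s < t
      · obtain ⟨hr, hrs, hst⟩ := h0
        rw [if_pos hrs, norm_smul, norm_mul, show g (t - s) = fracKernel γ (t - s) from
          indicator_of_mem (mem_Ioc.2 ⟨by linarith, by linarith⟩) _]
        refine mul_le_mul_of_nonneg_left ?_ (norm_nonneg _)
        rw [Real.norm_of_nonneg (by positivity)]
        exact (K (s - r)).le_of_opNorm_le (hM _ ⟨by linarith, by linarith⟩) _
      · refine le_trans (le_of_eq ?_) (norm_nonneg _)
        rw [norm_eq_zero]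
        split_ifs with hrs
        · by_cases hr : 0 < r
          · have hst : t - s ≤ 0 := by
              by_contra hc
              exact h0 ⟨hr, hrs, by linarith⟩
            rw [fracKernel_of_nonpos γ hst, zero_smul]
          · rw [show v r = 0 from indicator_of_notMem (fun h => hr h.1) _, map_zero, smul_zero]
        · rfl
  have hr : ∀ r ∈ Ioc 0 t, ∫ s, F s r = fracIntegral γ (fun s => K s (φ r)) (t - r) := by
    intro r hr
    rw [fracIntegral_eq_integral (by linarith [hr.2]),
      ← integral_add_right_eq_self (fun s => F s r) r]
    congr 1
    ext s
    simp only [hF, lt_add_iff_pos_left, add_sub_cancel_right, indicator, mem_Ioi, hv, if_pos hr]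
    split_ifs
    · congr 2
      ring
    · rw [smul_zero]
  have hl : ∀ s, ∫ r, F s r = fracKernel γ (t - s) •
      (Ioi (0 : ℝ)).indicator (fun s => ∫ r in (0 : ℝ)..s, K (s - r) (φ r)) s := by
    intro s
    rcases le_or_gt t s with hs | hs
    · simp [hF, fracKernel_of_nonpos γ (show t - s ≤ 0 by linarith)]
    · have h1 : ∀ r, F s r = fracKernel γ (t - s) •
          (Ioo 0 s).indicator (fun r => K (s - r) (φ r)) r := by
        intro r
        simp only [hF, hv, indicator, mem_Ioo, mem_Ioc]
        by_cases h0 : 0 < r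
        · by_cases hrs : r < s
          · rw [if_pos hrs, if_pos ⟨h0, by linarith⟩, if_pos ⟨h0, hrs⟩]
          · rw [if_neg hrs, if_neg (fun h => hrs h.2), smul_zero]
        · simp [h0]
      simp only [h1]
      rw [integral_smul, integral_indicator measurableSet_Ioo]
      by_cases h0 : 0 < s
      · rw [indicator_of_mem (mem_Ioi.2 h0), intervalIntegral.integral_of_le h0.le,
          integral_Ioc_eq_integral_Ioo]
      · rw [indicator_of_notMem (by simpa using h0), Ioo_eq_empty h0]
        simp
  have hright := hint.integral_prod_right
  constructor
  · rw [intervalIntegrable_iff_integrableOn_Ioc_of_le ht]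
    exact hright.integrableOn.congr_fun (fun r h => hr r h) measurableSet_Ioc
  · rw [fracIntegral_eq_integral ht, intervalIntegral.integral_of_le ht]
    simp only [← hl]
    rw [integral_integral_swap hint, ← setIntegral_congr_fun measurableSet_Ioc hr,
      setIntegral_eq_integral_of_forall_compl_eq_zero]
    intro r hr
    have : ∀ s, F s r = 0 := fun s => by
      simp [hF, show v r = 0 from indicator_of_notMem hr _]
    simp [this]

end Fubini

variable {𝕜 X : Type*} [RCLike 𝕜] [NormedAddCommGroup X] [NormedSpace ℝ X]
  [NormedSpace 𝕜 X] [IsScalarTower ℝ 𝕜 X] [CompleteSpace X]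

/-- The variation of parameters formula. -/
theorem IsResolvent.isMildSolution_volterra {γ : ℝ} (hγ : 0 < γ) {B : X →ₗ.[𝕜] X}
    {S : ℝ → X →L[ℝ] X} (hS : IsResolvent γ B S) (hB : B.IsClosed) {φ : ℝ → X}
    (hφ : ∀ a b, IntervalIntegrable φ volume a b) (c : X) :
    IsMildSolution γ B (fun t => c + ∫ s in (0 : ℝ)..t, φ s)
      (fun t => S t c + ∫ s in (0 : ℝ)..t, S (t - s) (φ s)) := by
  refine (hS.isMildSolution c).add hγ (isMildSolution_iff.2
    ⟨(continuous_volterra hS.continuous_uncurry hφ).continuousOn, fun t ht => ?_⟩)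
  have h1 := intervalIntegrable_volterra hS.continuous_uncurry (hφ 0 t) t
  obtain ⟨h2, h3⟩ := fracIntegral_volterra hγ ht hS.continuous_uncurry (hφ 0 t)
  rw [h3, ← intervalIntegral.integral_sub h1 (hφ 0 t)]
  -- For each `r` the mild equation with datum `φ r` at time `t - r` gives a point of the graph;
  -- these points are integrated over `r`.
  refine (B.graph.restrictScalars ℝ).intervalIntegral_prodMk_mem hB ht h2 (h1.sub (hφ 0 t))
    fun r hr => ?_
  exact (hS.isMildSolution (φ r)).mem_graph (sub_nonneg.2 hr.2)

theorem IsResolvent.exists_isMildSolution {γ : ℝ} (hγ : 0 < γ) {B : X →ₗ.[𝕜] X}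
    {S : ℝ → X →L[ℝ] X} (hS : IsResolvent γ B S) (hB : B.IsClosed) {f : ℝ → X}
    (hf : ∀ T, 0 < T → MemW11 T f) : ∃ u, IsMildSolution γ B f u := by
  obtain ⟨φ, hφ, hfφ⟩ := exists_intervalIntegrable_of_memW11 hf
  have h := hS.isMildSolution_volterra hγ hB hφ (f 0)
  refine ⟨_, isMildSolution_iff.2 ⟨h.1, fun t ht => ?_⟩⟩
  rw [hfφ t ht]
  exact h.mem_graph ht

end Forcing

/-! ### The square of the operator -/

section Square

variable {𝕜 X : Type*} [RCLike 𝕜] [NormedAddCommGroup X] [NormedSpace ℝ X]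
  [NormedSpace 𝕜 X]

theorem IsResolvent.continuous_formula {γ : ℝ} (hγ : 0 < γ) {A : X →ₗ.[𝕜] X}
    {S : ℝ → X →L[ℝ] X} (hS : IsResolvent γ A S) :
    Continuous fun p : X × X =>
      Real.Gamma (γ + 1) • (S 1 p.1 - p.1 - fracIntegral (γ + γ) (fun s => S s p.2) 1) := by
  have h := continuous_fracIntegral_apply hS.continuous_uncurry (add_pos hγ hγ) zero_le_one
  exact (((S 1).continuous.comp continuous_fst).sub continuous_fst |>.sub
    (h.comp continuous_snd)).const_smul _

theorem IsResolvent.apply_zero {γ : ℝ} {A : X →ₗ.[𝕜] X} {S : ℝ → X →L[ℝ] X}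
    (hS : IsResolvent γ A S) (x : X) : S 0 x = x := by
  have h := (hS.isMildSolution x).mem_graph le_rfl
  exact sub_eq_zero.1 (A.graph_fst_eq_zero_snd h (fracIntegral_zero_right _ _))

theorem IsResolvent.isStrongSolution {γ : ℝ} (hγ : 0 < γ) {A : X →ₗ.[𝕜] X}
    {S : ℝ → X →L[ℝ] X} (hS : IsResolvent γ A S) {x y : X} (hxy : (x, y) ∈ A.graph) :
    IsStrongSolution γ A (fun _ => x) fun t => S t x :=
  isStrongSolution_of_continuousOn hγ (hS.continuous x).continuousOn
    (hS.continuous y).continuousOn (hS.mem_graph x y hxy) (hS.eq_add_fracIntegral x y hxy)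

variable [CompleteSpace X]

/-- `A x` is a continuous function of the pair `(x, A² x)`. -/
theorem IsResolvent.eq_of_mem_graph {γ : ℝ} (hγ : 0 < γ) {A : X →ₗ.[𝕜] X}
    {S : ℝ → X →L[ℝ] X} (hS : IsResolvent γ A S) {x y z : X} (hxy : (x, y) ∈ A.graph)
    (hyz : (y, z) ∈ A.graph) :
    y = Real.Gamma (γ + 1) • (S 1 x - x - fracIntegral (γ + γ) (fun s => S s z) 1) := by
  have hz := (hS.continuous z).continuousOn (s := Ici 0)
  have h1 := hS.eq_add_fracIntegral x y hxy 1 zero_le_one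
  -- Inserting `S y = y + J^γ S z` into `S x = x + J^γ S y` leaves `y` only in `J^γ y = y / Γ(γ +
  -- 1)` at time `1`, so it can be solved for.
  rw [fracIntegral_congr zero_le_one (fun s hs => hS.eq_add_fracIntegral y z hyz s hs),
    fracIntegral_add hγ zero_le_one continuousOn_const (continuousOn_fracIntegral hγ hz),
    fracIntegral_const hγ zero_le_one, fracIntegral_fracIntegral hγ hγ zero_le_one hz,
    Real.one_rpow] at h1
  rw [h1, add_sub_cancel_left, add_sub_cancel_right, smul_smul, mul_one_div,
    div_self (Real.Gamma_pos_of_pos (by linarith)).ne', one_smul]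

theorem IsResolvent.isClosed_operatorSq {γ : ℝ} (hγ : 0 < γ) {A : X →ₗ.[𝕜] X}
    {S : ℝ → X →L[ℝ] X} (hS : IsResolvent γ A S) (hA : A.IsClosed) : (operatorSq A).IsClosed := by
  set Φ : X × X → X := fun p =>
    Real.Gamma (γ + 1) • (S 1 p.1 - p.1 - fracIntegral (γ + γ) (fun s => S s p.2) 1) with hΦ
  have hc : Continuous Φ := hS.continuous_formula hγ
  have hgraph : ((operatorSq A).graph : Set (X × X)) =
      (fun p : X × X => (p.1, Φ p)) ⁻¹' A.graph ∩ (fun p : X × X => (Φ p, p.2)) ⁻¹' A.graph := by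
    ext ⟨x, z⟩
    simp only [SetLike.mem_coe, mk_mem_graph_operatorSq_iff, mem_inter_iff, mem_preimage]
    constructor
    · rintro ⟨y, h1, h2⟩
      have h3 : y = Φ (x, z) := hS.eq_of_mem_graph hγ h1 h2
      exact h3 ▸ ⟨h1, h2⟩
    · rintro ⟨h1, h2⟩
      exact ⟨_, h1, h2⟩
  rw [LinearPMap.IsClosed, hgraph]
  exact (IsClosed.preimage (continuous_fst.prodMk hc) hA).inter
    (IsClosed.preimage (hc.prodMk continuous_snd) hA)

variable [IsScalarTower ℝ 𝕜 X]

/-- For `x ∈ D(A)` the normalised mean `c⁻¹ J^γ (S x) (t)` tends to `x` as `t → 0`. Its image under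
`A` is `c⁻¹ (S t x - x)`, again in `D(A)`. -/
theorem IsResolvent.dense_operatorSq {γ : ℝ} (hγ : 0 < γ) {A : X →ₗ.[𝕜] X}
    {S : ℝ → X →L[ℝ] X} (hS : IsResolvent γ A S) (hd : Dense (A.domain : Set X)) :
    Dense ((operatorSq A).domain : Set X) := by
  refine dense_closure.1 (hd.mono fun x hx => ?_)
  obtain ⟨y, hxy⟩ := LinearPMap.mem_domain_iff.1 hx
  rw [Metric.mem_closure_iff]
  intro ε hε
  have hcont : ContinuousAt (fun t => S t x) 0 := (hS.continuous x).continuousAt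
  obtain ⟨δ, hδ, hball⟩ := Metric.continuousAt_iff.1 hcont (ε / 2) (half_pos hε)
  set t := δ / 2 with ht
  have ht0 : 0 < t := half_pos hδ
  have hx' := (hS.continuous x).continuousOn (s := Ici 0)
  set c := t ^ γ / Real.Gamma (γ + 1) with hc
  have hc0 : 0 < c := div_pos (Real.rpow_pos_of_pos ht0 _) (Real.Gamma_pos_of_pos (by linarith))
  refine ⟨c⁻¹ • fracIntegral γ (fun s => S s x) t, ?_, ?_⟩
  · have h1 := (hS.isMildSolution x).mem_graph ht0.le
    have h2 := A.graph.sub_mem (hS.mem_graph x y hxy t ht0.le) hxy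
    have h3 : (c⁻¹ • fracIntegral γ (fun s => S s x) t, c⁻¹ • (S t y - y)) ∈
        (operatorSq A).graph :=
      LinearPMap.real_smul_mem_graph (mk_mem_graph_operatorSq_iff.2 ⟨_, h1, h2⟩) _
    exact LinearPMap.mem_domain_of_mem_graph h3
  · have h1 : x - c⁻¹ • fracIntegral γ (fun s => S s x) t
        = c⁻¹ • fracIntegral γ (fun s => x - S s x) t := by
      rw [fracIntegral_sub hγ ht0.le continuousOn_const hx', fracIntegral_const hγ ht0.le,
        smul_sub, smul_smul, ← hc, inv_mul_cancel₀ hc0.ne', one_smul]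
    have h2 : ‖fracIntegral γ (fun s => x - S s x) t‖ ≤ c * (ε / 2) := by
      refine norm_fracIntegral_le hγ ht0.le fun s hs => ?_
      have h3 := hball (x := s) (by
        rw [dist_zero_right, Real.norm_of_nonneg hs.1]
        linarith [hs.2])
      rw [hS.apply_zero, dist_eq_norm, norm_sub_rev] at h3
      exact h3.le
    rw [dist_eq_norm, h1, norm_smul, norm_inv, Real.norm_of_nonneg hc0.le,
      inv_mul_lt_iff₀ hc0]
    nlinarith

theorem eqOn_zero_of_isMildSolution_operatorSq {γ : ℝ} (hγ : 0 < γ) {A : X →ₗ.[𝕜] X}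
    (hA : A.IsClosed) {S : ℝ → X →L[ℝ] X} (hS : IsResolvent γ A S)
    (hplus : IsWellPosed γ A) (hminus : IsWellPosed γ (-A)) {w : ℝ → X}
    (hw : IsMildSolution (γ + γ) (operatorSq A) (fun _ => 0) w) : EqOn w 0 (Ici 0) := by
  set q : ℝ → X := fracIntegral γ w with hq
  set W : ℝ → X := fracIntegral (γ + γ) w with hW
  have hqc : ContinuousOn q (Ici 0) := continuousOn_fracIntegral hγ hw.1
  have hWc : ContinuousOn W (Ici 0) := continuousOn_fracIntegral (add_pos hγ hγ) hw.1
  have hqW : ∀ t, 0 ≤ t → fracIntegral γ q t = W t := fun t ht =>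
    fracIntegral_fracIntegral hγ hγ ht hw.1
  have hmem : ∀ t, 0 ≤ t → (W t, w t) ∈ (operatorSq A).graph := fun t ht => by
    simpa using hw.mem_graph ht
  -- `p = A W`, written through the resolvent so that its continuity is visible.
  set p : ℝ → X := fun t =>
    Real.Gamma (γ + 1) • (S 1 (W t) - W t - fracIntegral (γ + γ) (fun s => S s (w t)) 1) with hp
  have hpc : ContinuousOn p (Ici 0) :=
    (hS.continuous_formula hγ).comp_continuousOn (hWc.prodMk hw.1)
  have hWp : ∀ t, 0 ≤ t → (W t, p t) ∈ A.graph ∧ (p t, w t) ∈ A.graph := by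
    intro t ht
    obtain ⟨y, h1, h2⟩ := mk_mem_graph_operatorSq_iff.1 (hmem t ht)
    have h3 : y = p t := hS.eq_of_mem_graph hγ h1 h2
    exact h3 ▸ ⟨h1, h2⟩
  -- `A J^γ p = J^γ A p = J^γ w = q`; together with `A J^γ q = A W = p`, `A J^γ` interchanges `p`
  -- and `q`.
  have hJp : ∀ t, 0 ≤ t → (fracIntegral γ p t, q t) ∈ A.graph := fun t ht =>
    fracIntegral_mem_graph hγ ht hA hpc hw.1 fun s hs => (hWp s hs).2
  have hadd : IsMildSolution γ A (fun _ => 0) fun t => q t + p t := by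
    refine isMildSolution_iff.2 ⟨hqc.add hpc, fun t ht => ?_⟩
    rw [fracIntegral_add hγ ht hqc hpc, hqW t ht, sub_zero, add_comm (q t)]
    exact A.graph.add_mem (hWp t ht).1 (hJp t ht)
  have hsub : IsMildSolution γ (-A) (fun _ => 0) fun t => q t - p t := by
    refine isMildSolution_iff.2 ⟨hqc.sub hpc, fun t ht => ?_⟩
    rw [fracIntegral_sub hγ ht hqc hpc, hqW t ht, sub_zero, LinearPMap.mk_mem_neg_graph_iff,
      neg_sub]
    exact A.graph.sub_mem (hWp t ht).1 (hJp t ht)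
  have hq0 : EqOn q (fun _ => 0) (Ici 0) := by
    intro t ht
    have h1 : q t + p t = 0 := hplus.eqOn_zero_of_mild hγ hadd ht
    have h2 : q t - p t = 0 := hminus.eqOn_zero_of_mild hγ hsub ht
    have h3 : (2 : ℝ) • q t = 0 := by
      rw [show (2 : ℝ) • q t = (q t + p t) + (q t - p t) by module, h1, h2, add_zero]
    exact (smul_eq_zero.1 h3).resolve_left two_ne_zero
  intro t ht
  have hW0 : W t = 0 := by
    rw [← hqW t ht, fracIntegral_congr ht hq0]
    simp [fracIntegral]
  exact (operatorSq A).graph_fst_eq_zero_snd (hmem t ht) hW0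

theorem eqOn_of_isMildSolution_operatorSq {γ : ℝ} (hγ : 0 < γ) {A : X →ₗ.[𝕜] X}
    (hA : A.IsClosed) {S : ℝ → X →L[ℝ] X} (hS : IsResolvent γ A S)
    (hplus : IsWellPosed γ A) (hminus : IsWellPosed γ (-A)) {f u w : ℝ → X}
    (hu : IsMildSolution (γ + γ) (operatorSq A) f u)
    (hw : IsMildSolution (γ + γ) (operatorSq A) f w) : EqOn u w (Ici 0) := by
  have h := hu.sub (add_pos hγ hγ) hw
  simp only [sub_self] at h
  intro t ht
  exact sub_eq_zero.1 (eqOn_zero_of_isMildSolution_operatorSq hγ hA hS hplus hminus h ht)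

/-- Iterating the resolvent equation twice leaves the first-order term `J^γ y`, which has opposite
signs for `A` and `-A` and drops out of the mean. -/
theorem IsResolvent.isStrongSolution_operatorSq {γ : ℝ} (hγ : 0 < γ) {A : X →ₗ.[𝕜] X}
    {S R : ℝ → X →L[ℝ] X} (hS : IsResolvent γ A S) (hR : IsResolvent γ (-A) R) {x y z : X}
    (hxy : (x, y) ∈ A.graph) (hyz : (y, z) ∈ A.graph) :
    IsStrongSolution (γ + γ) (operatorSq A) (fun _ => x)
      fun t => (1 / 2 : ℝ) • (S t x + R t x) := by
  have hxy' : (x, -y) ∈ (-A).graph := LinearPMap.mk_mem_neg_graph_iff.2 (by simpa using hxy)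
  have hyz' : (-y, z) ∈ (-A).graph :=
    LinearPMap.mk_mem_neg_graph_iff.2 (by simpa using A.graph.neg_mem hyz)
  have hSc := fun x => (hS.continuous x).continuousOn (s := Ici 0)
  have hRc := fun x => (hR.continuous x).continuousOn (s := Ici 0)
  have key : ∀ {T : ℝ → X →L[ℝ] X} {B : X →ₗ.[𝕜] X}, IsResolvent γ B T → ∀ {y : X},
      (x, y) ∈ B.graph → (y, z) ∈ B.graph → ∀ t, 0 ≤ t →
      T t x = x + (fracIntegral γ (fun _ => y) t + fracIntegral (γ + γ) (fun s => T s z) t) := by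
    intro T B hT y h1 h2 t ht
    have hz := (hT.continuous z).continuousOn (s := Ici 0)
    rw [hT.eq_add_fracIntegral x y h1 t ht,
      fracIntegral_congr ht (fun s hs => hT.eq_add_fracIntegral y z h2 s hs),
      fracIntegral_add hγ ht continuousOn_const (continuousOn_fracIntegral hγ hz),
      fracIntegral_fracIntegral hγ hγ ht hz]
  refine isStrongSolution_of_continuousOn (add_pos hγ hγ)
    (v := fun t => (1 / 2 : ℝ) • (S t z + R t z))
    (((hSc x).add (hRc x)).const_smul _) (((hSc z).add (hRc z)).const_smul _)
    (fun t ht => ?_) fun t ht => ?_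
  · refine LinearPMap.real_smul_mem_graph ?_ _
    have h1 := hR.mem_graph _ _ hxy' t ht
    have h2 := hR.mem_graph _ _ hyz' t ht
    rw [LinearPMap.mk_mem_neg_graph_iff, map_neg, neg_neg] at h1
    rw [LinearPMap.mk_mem_neg_graph_iff, map_neg] at h2
    have h3 : (R t y, R t z) ∈ A.graph := by simpa using A.graph.neg_mem h2
    exact mk_mem_graph_operatorSq_iff.2 ⟨S t y + R t y,
      A.graph.add_mem (hS.mem_graph x y hxy t ht) h1,
      A.graph.add_mem (hS.mem_graph y z hyz t ht) h3⟩
  · rw [fracIntegral_smul, fracIntegral_add (add_pos hγ hγ) ht (hSc z) (hRc z),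
      key hS hxy hyz t ht, key hR hxy' hyz' t ht, fracIntegral_neg]
    module

/-- By uniqueness every strong solution is the mean of the two resolvents, so continuous dependence
is inherited from both equations. -/
theorem isWellPosed_operatorSq {γ : ℝ} (hγ : 0 < γ) {A : X →ₗ.[𝕜] X}
    (hA : A.IsClosed) {S R : ℝ → X →L[ℝ] X} (hS : IsResolvent γ A S)
    (hR : IsResolvent γ (-A) R) (hplus : IsWellPosed γ A) (hminus : IsWellPosed γ (-A)) :
    IsWellPosed (γ + γ) (operatorSq A) := by
  have h2 := add_pos hγ hγ
  have hcl := hS.isClosed_operatorSq hγ hA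
  have hmem : ∀ x ∈ (operatorSq A).domain, ∃ y z, (x, y) ∈ A.graph ∧ (y, z) ∈ A.graph := by
    intro x hx
    obtain ⟨z, hz⟩ := LinearPMap.mem_domain_iff.1 hx
    obtain ⟨y, hy⟩ := mk_mem_graph_operatorSq_iff.1 hz
    exact ⟨y, z, hy⟩
  have huniq : ∀ x u w, IsStrongSolution (γ + γ) (operatorSq A) (fun _ => x) u →
      IsStrongSolution (γ + γ) (operatorSq A) (fun _ => x) w → EqOn u w (Ici 0) :=
    fun x u w hu hw => eqOn_of_isMildSolution_operatorSq hγ hA hS hplus hminus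
      (hu.isMildSolution h2 hcl) (hw.isMildSolution h2 hcl)
  refine ⟨fun x hx => ?_, fun x _ => huniq x, fun x u hx hu hx0 T hT => ?_⟩
  · obtain ⟨y, z, hxy, hyz⟩ := hmem x hx
    exact ⟨_, hS.isStrongSolution_operatorSq hγ hR hxy hyz⟩
  · choose y z hxy hyz using fun n => hmem (x n) (hx n)
    have hxy' : ∀ n, (x n, -y n) ∈ (-A).graph := fun n =>
      LinearPMap.mk_mem_neg_graph_iff.2 (by simpa using hxy n)
    have h3 := hplus.continuous_dependence x (fun n t => S t (x n))
      (fun n => LinearPMap.mem_domain_of_mem_graph (hxy n))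
      (fun n => hS.isStrongSolution hγ (hxy n)) hx0 T hT
    have h4 := hminus.continuous_dependence x (fun n t => R t (x n))
      (fun n => LinearPMap.mem_domain_of_mem_graph (hxy' n))
      (fun n => hR.isStrongSolution hγ (hxy' n)) hx0 T hT
    rw [Metric.tendstoUniformlyOn_iff] at h3 h4 ⊢
    intro ε hε
    filter_upwards [h3 ε hε, h4 ε hε] with n hn3 hn4 t ht
    have h5 : u n t = (1 / 2 : ℝ) • (S t (x n) + R t (x n)) :=
      huniq (x n) _ _ (hu n) (hS.isStrongSolution_operatorSq hγ hR (hxy n) (hyz n)) ht.1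
    have h6 := hn3 t ht
    have h7 := hn4 t ht
    rw [dist_zero_left] at h6 h7 ⊢
    rw [h5, norm_smul, Real.norm_of_nonneg (by norm_num)]
    linarith [norm_add_le (S t (x n)) (R t (x n))]

/-- `A J^(2γ) (u + w) = J^γ (u - f) - J^γ (w - f) = J^γ (u - w)`, where the forcing cancels; a
second `A` gives `u + w - 2 f`. -/
theorem isMildSolution_operatorSq {γ : ℝ} (hγ : 0 < γ) {A : X →ₗ.[𝕜] X} (hA : A.IsClosed)
    {f u w : ℝ → X} (hf : ContinuousOn f (Ici 0)) (hu : IsMildSolution γ A f u)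
    (hw : IsMildSolution γ (-A) f w) :
    IsMildSolution (γ + γ) (operatorSq A) f fun t => (1 / 2 : ℝ) • (u t + w t) := by
  refine isMildSolution_iff.2 ⟨(hu.1.add hw.1).const_smul _, fun t ht => ?_⟩
  have hw' : ∀ s, 0 ≤ s → (fracIntegral γ w s, -(w s - f s)) ∈ A.graph := fun s hs =>
    LinearPMap.mk_mem_neg_graph_iff.1 (hw.mem_graph hs)
  have h1 := fracIntegral_mem_graph hγ ht hA (continuousOn_fracIntegral hγ hu.1)
    (v := fun s => u s - f s) (hu.1.sub hf) fun s hs => hu.mem_graph hs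
  have h2 := fracIntegral_mem_graph hγ ht hA (continuousOn_fracIntegral hγ hw.1)
    (v := fun s => -(w s - f s)) (hw.1.sub hf).neg hw'
  rw [fracIntegral_fracIntegral hγ hγ ht hu.1, fracIntegral_sub hγ ht hu.1 hf] at h1
  rw [fracIntegral_fracIntegral hγ hγ ht hw.1, fracIntegral_neg,
    fracIntegral_sub hγ ht hw.1 hf] at h2
  rw [fracIntegral_smul, fracIntegral_add (add_pos hγ hγ) ht hu.1 hw.1]
  have h3 : (fracIntegral (γ + γ) u t + fracIntegral (γ + γ) w t,
      fracIntegral γ u t - fracIntegral γ w t) ∈ A.graph := by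
    convert A.graph.add_mem h1 h2 using 1
    rw [Prod.mk_add_mk]
    congr 1
    abel
  have h4 : (fracIntegral γ u t - fracIntegral γ w t, (u t - f t) + (w t - f t)) ∈ A.graph := by
    convert A.graph.sub_mem (hu.mem_graph ht) (hw' t ht) using 1
    rw [Prod.mk_sub_mk, sub_neg_eq_add]
  convert LinearPMap.real_smul_mem_graph (mk_mem_graph_operatorSq_iff.2 ⟨_, h3, h4⟩) (1 / 2 : ℝ)
    using 2
  module

end Square

theorem mainTheorem2 {𝕜 X : Type*} [RCLike 𝕜] [NormedAddCommGroup X] [NormedSpace ℝ X]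
    [NormedSpace 𝕜 X] [IsScalarTower ℝ 𝕜 X] [CompleteSpace X]
    (α : ℝ) (hα : 0 < α) (hα2 : α ≤ 2)
    (f : ℝ → X) (hf : ContinuousOn f (Ici 0)) (hfW : ∀ T, 0 < T → MemW11 T f)
    (A : X →ₗ.[𝕜] X) (hAdense : Dense (A.domain : Set X)) (hAclosed : A.IsClosed)
    (hplus : IsWellPosed (α / 2) A) (hminus : IsWellPosed (α / 2) (-A)) :
    (Dense ((operatorSq A).domain : Set X) ∧ (operatorSq A).IsClosed) ∧
    IsWellPosed α (operatorSq A) ∧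
    ∃ uplus uminus u : ℝ → X,
      IsUniqueMildSolution (α / 2) A f uplus ∧
      IsUniqueMildSolution (α / 2) (-A) f uminus ∧
      IsUniqueMildSolution α (operatorSq A) f u ∧
      ∀ t, 0 ≤ t → u t = (1 / 2 : ℝ) • (uplus t + uminus t) := by
  have hγ : 0 < α / 2 := half_pos hα
  have hadd : α / 2 + α / 2 = α := add_halves α
  obtain ⟨S, hS⟩ := hplus.exists_resolvent hγ hAclosed hAdense
  obtain ⟨R, hR⟩ := hminus.exists_resolvent hγ hAclosed.neg hAdense
  obtain ⟨u, hu⟩ := hS.exists_isMildSolution hγ hAclosed hfW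
  obtain ⟨w, hw⟩ := hR.exists_isMildSolution hγ hAclosed.neg hfW
  have hwp := isWellPosed_operatorSq hγ hAclosed hS hR hplus hminus
  have hmild := isMildSolution_operatorSq hγ hAclosed hf hu hw
  rw [hadd] at hwp hmild
  exact ⟨⟨hS.dense_operatorSq hγ hAdense, hS.isClosed_operatorSq hγ hAclosed⟩, hwp, u, w, _,
    ⟨hu, fun v hv => hplus.eqOn_of_mild hγ hv hu⟩,
    ⟨hw, fun v hv => hminus.eqOn_of_mild hγ hv hw⟩,
    ⟨hmild, fun v hv => hwp.eqOn_of_mild hα hv hmild⟩, fun t _ => rfl⟩
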